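/- Let $N\ge 3$, $M=\{1,\dots,N\}$, $1\le k\le N-2$, and let $J_k\subset M$ have $k$ elements. For each $j\in J_k$ let $(n_j^{(\lambda)})_{\lambda\ge1}$ be a lacunary sequence, i.e. a sequence of positive integers with $n_j^{(1)}=1$ and $n_j^{(\lambda+1)}/n_j^{(\lambda)}\ge q_j$ for all $\lambda\ge 1$, where $q_j>1$ is a constant. For $f\in L_2(\mathbb T^N)$, $\mathbb T^N=[-\pi,\pi)^N$ (functions being $2\pi$-periodic in each variable), with Fourier coefficients $c_\nu=(2\pi)^{-N}\int_{\mathbb T^N}f(x)e^{-i(\nu x)}\,dx$, where $(\nu x)=\nu_1x_1+\dots+\nu_Nx_N$, and for $n=(n_1,\dots,n_N)$ with integers $n_j\ge 0$, put $$S_n(x;f)=\sum_{|\nu_1|\le n_1}\dots\sum_{|\nu_N|\le n_N}c_\nu e^{i(\nu x)} .$$ Let $n^{(\lambda,m)}$ denote the vector whose components with $j\in J_k$ are $n_j=n_j^{(\lambda_j)}$ and whose remaining (free) components form $m=(n_l)_{l\in M\setminus J_k}$. Let $1\le s\le N-k$ and let $\nu_1,\dots,\nu_s\in M\setminus J_k$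 be distinct. For integers $p_{\nu_1},\dots,p_{\nu_s}\ge 1$ put $$Q^{(p_{\nu_1},\dots,p_{\nu_s})}_{n^{(\lambda,m)}}(x;f)=\sum_{n_{\nu_1}=0}^{p_{\nu_1}}\dots\sum_{n_{\nu_s}=0}^{p_{\nu_s}}S_{n^{(\lambda,m)}}(x;f).$$ Then for every $f\in L_2(\mathbb T^N)$ and for almost every $x\in\mathbb T^N$ $$Q^{(p_{\nu_1},\dots,p_{\nu_s})}_{n^{(\lambda,m)}}(x;f)=O\Big(\prod_{j=1}^s p_{\nu_j}\prod_{l\in M\setminus J_k,\ l\ne\nu_1,\dots,\nu_s}\sqrt{\log(|n_l|+2)}\Big),$$ that is, there is a finite $C=C(x)$, which may depend on $x$, $f$, the lacunary sequences and $\nu_1,\dots,\nu_s$, such that the left side is at most $C(x)$ times the product in parentheses in absolute value, simultaneously for all $\lambda_j\ge 1$ ($j\in J_k$), all integers $n_l\ge 0$ ($l\in M\setminus J_k$, $l\ne\nu_1,\dots,\nu_s$) and all integers $p_{\nu_1},\dots,p_{\nu_s}\ge 1$. -/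

import Mathlib

open MeasureTheory

noncomputable section

instance twoPiPosFact : Fact (0 < 2 * Real.pi) := ⟨Real.two_pi_pos⟩

/-- The `N`-dimensional torus `𝕋^N = (ℝ / 2πℤ)^N`. Its `volume` is the product Lebesgue measure,
of total mass `(2π)^N`. -/
abbrev Torus (N : ℕ) : Type := Fin N → AddCircle (2 * Real.pi)

/-- The exponential `e^{i(νx)}`, `(νx) = ν₁x₁ + ⋯ + ν_Nx_N`, as a function on `𝕋^N`
(Mathlib's `fourier k` on `ℝ / 2πℤ` is `t ↦ e^{ikt}`). -/
def torusExp {N : ℕ} (ν : Fin N → ℤ) (x : Torus N) : ℂ :=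
  ∏ j, fourier (ν j) (x j)

/-- The Fourier coefficient `c_ν(f) = (2π)^{-N} ∫_{𝕋^N} f(x) e^{-i(νx)} dx`. -/
def torusCoeff {N : ℕ} (f : Torus N → ℂ) (ν : Fin N → ℤ) : ℂ :=
  ((2 * Real.pi : ℝ) : ℂ)⁻¹ ^ N * ∫ x : Torus N, f x * torusExp (-ν) x

/-- The rectangular partial sum `S_n(x; f)`: the sum of `c_ν(f) e^{i(νx)}` over all `ν ∈ ℤ^N`
with `|ν_j| ≤ n_j` for every `j`. -/
def rectPartialSum {N : ℕ} (f : Torus N → ℂ) (n : Fin N → ℕ) (x : Torus N) : ℂ :=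
  ∑ ν ∈ Fintype.piFinset (fun j => Finset.Icc (-(n j : ℤ)) (n j)),
    torusCoeff f ν * torusExp ν x

/-- A lacunary sequence of natural numbers: it starts with `1` and all quotients of consecutive
terms are at least some fixed `q > 1`. The enumeration starts at `0`. -/
def IsLacunary (a : ℕ → ℕ) : Prop :=
  a 0 = 1 ∧ ∃ q : ℝ, 1 < q ∧ ∀ s, q ≤ (a (s + 1) : ℝ) / (a s : ℝ)

/-- The index vector whose component `j ∈ J` is the term number `lam j` of the sequence `a j`, and
whose component `j ∉ J` is the free number `m j`. -/
def lacIndex {N : ℕ} (J : Finset (Fin N)) (a : Fin N → ℕ → ℕ) (lam m : Fin N → ℕ) : Fin N → ℕ :=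
  fun j => if j ∈ J then a j (lam j) else m j

/-- The sum of the `J`-lacunary partial sums of `f` where each free component `j ∈ T` of the index
runs over `0, …, p j`, while the other free components keep the values `m j`. -/
def lacSum {N : ℕ} (J : Finset (Fin N)) (a : Fin N → ℕ → ℕ) (T : Finset (Fin N))
    (f : Torus N → ℂ) (lam m p : Fin N → ℕ) (x : Torus N) : ℂ :=
  ∑ r ∈ Fintype.piFinset (fun j => if j ∈ T then Finset.range (p j + 1) else {m j}),
    rectPartialSum f (lacIndex J a lam r) x

end

open scoped ENNReal NNReal ComplexConjugate

/-! ### One-dimensional kernels -/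

/-! Summing the cutoffs `1_{|k| ≤ r}` over `r ≤ p` gives `p + 1` times the Fejér weight. Hence the
mixed sum equals `∏ (p_j + 1) ∏ √log (m_l + 2)` times the action on `f` of a product multiplier: a
sharp lacunary cutoff in the coordinates of `J`, a Fejér weight in those of `T`, and a cutoff
divided by `√log` in the remaining ones (`prod_sum_mixed`, `lacSum_eq`). It suffices that the
maximal function of this multiplier family, over all indices at once, is bounded on `L²` for
trigonometric polynomials (`HasMaximalBound`); Fatou's lemma and Bessel's inequality then give
almost everywhere finiteness for `f` (`HasMaximalBound.ae_iSup_lt_top`).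

The free coordinates are treated together (`hasMaximalBound_free`). A measurable choice `κ x` of the
order linearizes the supremum and the `TT*` method applies (`lintegral_enorm_sum_sq_le_of_kernel`).
The composite kernel at `(x, y)` contains Dirichlet kernels of order `min (κ x j) (κ y j)`, so it is
bounded by the geometric mean of a majorant depending on `κ x` and one depending on `κ y`. The
integral of a Dirichlet majorant is `O(log)`, which the weights cancel.

A Fejér coordinate is added by the maximal theorem for positive kernels, applied to the previous
maximal function (`HasMaximalBound.mul_fejerWeight`). That theorem (`lintegral_iSup_kernel_sq_le`)
rests on `φ_p * φ_q ≤ c (φ_p + φ_q)`: the linearized operator satisfies `T T* ≤ c (T + T*)`, so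
`‖T‖² ≤ 2c ‖T‖`.

A lacunary coordinate is compared with the Fejér weight of the same order
(`HasMaximalBound.mul_lacunary`). The differences are square summable along the sequence, uniformly
in the frequency, so a sum over the orders replaces the supremum. -/

/-- The circle `ℝ / 2πℤ`. -/
abbrev Circ : Type := AddCircle (2 * Real.pi)

/-- The geometric sum `∑_{k < n} e^{ikt}`. -/
noncomputable def geomKernel (n : ℕ) (t : Circ) : ℂ := ∑ k ∈ Finset.range n, fourier (k : ℤ) t

/-- The Dirichlet kernel `∑_{|k| ≤ m} e^{ikt}`. -/
noncomputable def dirichletKernel (m : ℕ) (t : Circ) : ℂ :=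
  ∑ k ∈ Finset.Icc (-(m : ℤ)) m, fourier k t

/-- The Fejér weight `(1 - |k| / (p + 1))₊`. -/
noncomputable def fejerWeight (p : ℕ) (k : ℤ) : ℝ := max 0 (1 - |(k : ℝ)| / (p + 1))

lemma norm_fourier_apply (k : ℤ) (t : Circ) : ‖fourier k t‖ = 1 := by
  rw [fourier_apply]; exact Circle.norm_coe _

lemma norm_geomKernel_le (n : ℕ) (t : Circ) : ‖geomKernel n t‖ ≤ n := by
  refine (norm_sum_le _ _).trans ?_
  simp only [norm_fourier_apply]
  simp

/-- For a representative `y ∈ (-π, π]` one has `|e^{iy} - 1| = 2 |sin (y/2)|`, and Jordan's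
inequality `sin u ≥ 2u/π` on `[0, π/2]` applies. -/
lemma norm_circ_le_norm_fourier_one_sub_one (t : Circ) :
    ‖t‖ * 2 ≤ Real.pi * ‖fourier 1 t - 1‖ := by
  obtain ⟨y, hy, rfl⟩ : ∃ y ∈ Set.Ioc (-Real.pi) (-Real.pi + 2 * Real.pi), (y : Circ) = t := by
    have := AddCircle.coe_image_Ioc_eq (2 * Real.pi) (-Real.pi)
    have ht : t ∈ ((↑) : ℝ → Circ) '' Set.Ioc (-Real.pi) (-Real.pi + 2 * Real.pi) := by
      rw [this]; trivial
    exact ht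
  have hπ := Real.pi_pos
  have habs : |y| ≤ Real.pi := abs_le.2 ⟨hy.1.le, by linarith [hy.2]⟩
  have h1 : ‖(y : Circ)‖ = |y| := by
    rw [AddCircle.norm_coe_eq_abs_iff _ Real.two_pi_pos.ne', abs_of_pos Real.two_pi_pos]
    linarith
  have h2 : fourier 1 (y : Circ) = Complex.exp (Complex.I * y) := by
    rw [fourier_coe_apply]
    congr 1
    have : (Real.pi : ℂ) ≠ 0 := by exact_mod_cast hπ.ne'
    push_cast
    field_simp
  rw [h1, h2, Complex.norm_exp_I_mul_ofReal_sub_one, norm_mul, Real.norm_eq_abs, Real.norm_eq_abs,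
    abs_two]
  have h3 : 2 / Real.pi * |y / 2| ≤ |Real.sin (y / 2)| := by
    have h4 : |y / 2| = |y| / 2 := by rw [abs_div, abs_two]
    have := Real.mul_le_sin (x := |y / 2|) (abs_nonneg _) (by rw [h4]; linarith)
    refine this.trans ?_
    rcases abs_cases (y / 2) with ⟨h, _⟩ | ⟨h, _⟩ <;> rw [h]
    · exact le_abs_self _
    · rw [Real.sin_neg]; exact neg_le_abs _
  rw [abs_div, abs_two] at h3
  have h5 : 2 / Real.pi * (|y| / 2) = |y| / Real.pi := by field_simp
  rw [h5, div_le_iff₀ hπ] at h3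
  nlinarith

lemma geomKernel_mul (n : ℕ) (t : Circ) :
    geomKernel n t * (fourier 1 t - 1) = fourier (n : ℤ) t - 1 := by
  have h : ∀ k : ℕ, fourier (k : ℤ) t = (fourier 1 t) ^ k := by
    intro k
    induction k with
    | zero => simp
    | succ k ih => rw [Nat.cast_succ, fourier_add, ih, pow_succ]
  simp only [geomKernel, h]
  exact geom_sum_mul _ _

lemma norm_geomKernel_mul_norm_le (n : ℕ) (t : Circ) : ‖geomKernel n t‖ * ‖t‖ ≤ Real.pi := by
  have h1 : ‖geomKernel n t‖ * ‖fourier 1 t - 1‖ ≤ 2 := by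
    rw [← norm_mul, geomKernel_mul]
    refine (norm_sub_le _ _).trans ?_
    rw [norm_fourier_apply, norm_one]; norm_num
  have h2 := norm_circ_le_norm_fourier_one_sub_one t
  have h3 := mul_le_mul_of_nonneg_left h2 (norm_nonneg (geomKernel n t))
  have h4 := mul_le_mul_of_nonneg_left h1 Real.pi_pos.le
  linarith

lemma dirichletKernel_eq (m : ℕ) (t : Circ) :
    dirichletKernel m t = fourier (-(m : ℤ)) t * geomKernel (2 * m + 1) t := by
  rw [geomKernel, Finset.mul_sum, dirichletKernel]
  symm
  refine Finset.sum_bij (fun k _ => -(m : ℤ) + k) ?_ ?_ ?_ ?_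
  · intro k hk
    rw [Finset.mem_range] at hk
    rw [Finset.mem_Icc]; omega
  · intro a _ b _ h
    have : -(m : ℤ) + a = -(m : ℤ) + b := h
    omega
  · intro b hb
    rw [Finset.mem_Icc] at hb
    exact ⟨(b + m).toNat, by rw [Finset.mem_range]; omega, by omega⟩
  · intro k _
    rw [← fourier_add]

lemma norm_dirichletKernel (m : ℕ) (t : Circ) :
    ‖dirichletKernel m t‖ = ‖geomKernel (2 * m + 1) t‖ := by
  rw [dirichletKernel_eq, norm_mul, norm_fourier_apply, one_mul]

/-- The majorant `(m + 1) / (1 + (m + 1)|t|)` of the Dirichlet kernel. -/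
noncomputable def dirichletMajorant (m : ℕ) (t : Circ) : ℝ :=
  (2 + Real.pi) * ((m + 1) / (1 + (m + 1) * ‖t‖))

/-- The majorant `n / (1 + n²t²)`, `n = p + 1`, of the Fejér kernel. -/
noncomputable def fejerMajorant (p : ℕ) (t : Circ) : ℝ :=
  (p + 1) / (1 + (p + 1) ^ 2 * ‖t‖ ^ 2)

lemma dirichletMajorant_nonneg (m : ℕ) (t : Circ) : 0 ≤ dirichletMajorant m t := by
  have := Real.pi_pos
  unfold dirichletMajorant; positivity

lemma fejerMajorant_nonneg (m : ℕ) (t : Circ) : 0 ≤ fejerMajorant m t := by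
  unfold fejerMajorant; positivity

lemma continuous_dirichletMajorant (m : ℕ) : Continuous (dirichletMajorant m) := by
  unfold dirichletMajorant
  refine continuous_const.mul (continuous_const.div (by fun_prop) fun t => ?_)
  positivity

lemma continuous_fejerMajorant (m : ℕ) : Continuous (fejerMajorant m) := by
  unfold fejerMajorant
  refine continuous_const.div (by fun_prop) fun t => ?_
  positivity

lemma dirichletMajorant_neg (m : ℕ) (t : Circ) :
    dirichletMajorant m (-t) = dirichletMajorant m t := by
  simp [dirichletMajorant]

lemma fejerMajorant_neg (m : ℕ) (t : Circ) : fejerMajorant m (-t) = fejerMajorant m t := by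
  simp [fejerMajorant]

/-- The trivial bound `2m + 1` and `m + 1` times the decay bound `‖D‖ ‖t‖ ≤ π` are added, which
produces the constant `2 + π`. -/
lemma norm_dirichletKernel_le (m : ℕ) (t : Circ) :
    ‖dirichletKernel m t‖ ≤ dirichletMajorant m t := by
  rw [norm_dirichletKernel, dirichletMajorant, ← mul_div_assoc, le_div_iff₀ (by positivity)]
  have h1 := norm_geomKernel_le (2 * m + 1) t
  have h2 := norm_geomKernel_mul_norm_le (2 * m + 1) t
  push_cast at h1
  have h3 := mul_le_mul_of_nonneg_left h2 (by positivity : (0 : ℝ) ≤ m + 1)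
  have hm : (0 : ℝ) ≤ m := by positivity
  nlinarith

/-- This lets a kernel of order `min m m'` be estimated by the majorant of either order. -/
lemma dirichletMajorant_mono {m n : ℕ} (h : m ≤ n) (t : Circ) :
    dirichletMajorant m t ≤ dirichletMajorant n t := by
  have := Real.pi_pos
  unfold dirichletMajorant
  refine mul_le_mul_of_nonneg_left ?_ (by positivity)
  have h' : (m : ℝ) ≤ n := by exact_mod_cast h
  rw [div_le_div_iff₀ (by positivity) (by positivity)]
  nlinarith [norm_nonneg t]

lemma fejerMajorant_le_of_norm_le (p : ℕ) {s t : Circ} (h : ‖t‖ ≤ 2 * ‖s‖) :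
    fejerMajorant p s ≤ 4 * fejerMajorant p t := by
  unfold fejerMajorant
  rw [← mul_div_assoc, div_le_div_iff₀ (by positivity) (by positivity)]
  have h1 : ‖t‖ ^ 2 ≤ 4 * ‖s‖ ^ 2 := by nlinarith [norm_nonneg t]
  have h2 : ((p : ℝ) + 1) ^ 2 * ‖t‖ ^ 2 ≤ (p + 1) ^ 2 * (4 * ‖s‖ ^ 2) :=
    mul_le_mul_of_nonneg_left h1 (by positivity)
  have h3 : 1 + ((p : ℝ) + 1) ^ 2 * ‖t‖ ^ 2 ≤ 4 * (1 + (p + 1) ^ 2 * ‖s‖ ^ 2) := by linarith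
  calc ((p : ℝ) + 1) * (1 + (p + 1) ^ 2 * ‖t‖ ^ 2)
      ≤ (p + 1) * (4 * (1 + (p + 1) ^ 2 * ‖s‖ ^ 2)) :=
        mul_le_mul_of_nonneg_left h3 (by positivity)
    _ = _ := by ring

lemma fejerMajorant_le (p : ℕ) (t : Circ) : fejerMajorant p t ≤ p + 1 := by
  unfold fejerMajorant
  refine div_le_self (by positivity) ?_
  have : (0 : ℝ) ≤ ((p : ℝ) + 1) ^ 2 * ‖t‖ ^ 2 := by positivity
  linarith

/-- The Fejér kernel `|∑_{k ≤ p} e^{ikt}|² / (p + 1)`. -/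
noncomputable def fejerKernel (p : ℕ) (t : Circ) : ℝ := ‖geomKernel (p + 1) t‖ ^ 2 / (p + 1)

lemma fejerKernel_nonneg (p : ℕ) (t : Circ) : 0 ≤ fejerKernel p t := by
  unfold fejerKernel; positivity

lemma continuous_geomKernel (n : ℕ) : Continuous (geomKernel n) := by
  unfold geomKernel; fun_prop

lemma continuous_fejerKernel (p : ℕ) : Continuous (fejerKernel p) := by
  have := continuous_geomKernel (p + 1)
  unfold fejerKernel; fun_prop

lemma fejerKernel_le (p : ℕ) (t : Circ) :
    fejerKernel p t ≤ (1 + Real.pi ^ 2) * fejerMajorant p t := by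
  unfold fejerKernel fejerMajorant
  rw [← mul_div_assoc, div_le_div_iff₀ (by positivity) (by positivity)]
  have h1 := norm_geomKernel_le (p + 1) t
  have h2 := norm_geomKernel_mul_norm_le (p + 1) t
  push_cast at h1
  have h3 : ‖geomKernel (p + 1) t‖ ^ 2 ≤ (p + 1) ^ 2 := by gcongr
  have h4 : (‖geomKernel (p + 1) t‖ * ‖t‖) ^ 2 ≤ Real.pi ^ 2 := by gcongr
  have h5 := mul_le_mul_of_nonneg_left h4 (by positivity : (0 : ℝ) ≤ (p + 1) ^ 2)
  nlinarith

/-! ### Fejér weights, cutoffs and the kernels they generate. -/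

lemma fejerWeight_nonneg (p : ℕ) (k : ℤ) : 0 ≤ fejerWeight p k := le_max_left _ _

lemma fejerWeight_eq_zero {p : ℕ} {k : ℤ} (h : (p : ℤ) < |k|) : fejerWeight p k = 0 := by
  unfold fejerWeight
  refine max_eq_left ?_
  have : (p : ℝ) + 1 ≤ |(k : ℝ)| := by exact_mod_cast h
  rw [sub_nonpos, le_div_iff₀ (by positivity)]; linarith

lemma fejerWeight_of_le {p : ℕ} {k : ℤ} (h : |k| ≤ p) :
    fejerWeight p k = 1 - |(k : ℝ)| / (p + 1) := by
  unfold fejerWeight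
  refine max_eq_right ?_
  have : |(k : ℝ)| ≤ p := by exact_mod_cast h
  rw [sub_nonneg, div_le_one (by positivity)]; linarith

/-- For `|k| ≤ p` there are `p + 1 - |k|` values of `r` in `[|k|, p]`, otherwise none. -/
lemma sum_range_ite_abs_le (p : ℕ) (k : ℤ) :
    (∑ r ∈ Finset.range (p + 1), if |k| ≤ (r : ℤ) then (1 : ℝ) else 0)
      = (p + 1) * fejerWeight p k := by
  induction p with
  | zero =>
    by_cases h : |k| ≤ 0
    · have : k = 0 := abs_nonpos_iff.1 h
      subst this; simp [fejerWeight]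
    · rw [fejerWeight_eq_zero (by simpa using h)]
      have : k ≠ 0 := by simpa using h
      simp [this]
  | succ p ih =>
    rw [Finset.sum_range_succ, ih]
    by_cases h : |k| ≤ ((p + 1 : ℕ) : ℤ)
    · rw [if_pos h, fejerWeight_of_le h]
      rcases h.lt_or_eq with h1 | h1
      · rw [fejerWeight_of_le (by push_cast at h1; omega)]
        push_cast
        field_simp
        ring
      · rw [fejerWeight_eq_zero (by rw [h1]; push_cast; omega)]
        have : |(k : ℝ)| = p + 1 := by exact_mod_cast h1
        rw [this]; push_cast; field_simp; ring
    · rw [if_neg h, fejerWeight_eq_zero (by omega), fejerWeight_eq_zero (by push_cast at h ⊢; omega)]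
      simp

lemma dirichletKernel_eq_sum {m R : ℕ} (h : m ≤ R) (t : Circ) :
    dirichletKernel m t = ∑ k ∈ Finset.Icc (-(R : ℤ)) R,
      ((if |k| ≤ (m : ℤ) then (1 : ℝ) else 0 : ℝ) : ℂ) * fourier k t := by
  unfold dirichletKernel
  have : ∀ k : ℤ, ((if |k| ≤ (m : ℤ) then (1 : ℝ) else 0 : ℝ) : ℂ) * fourier k t
      = if |k| ≤ (m : ℤ) then fourier k t else 0 := by
    intro k; split_ifs <;> simp
  simp only [this]
  rw [← Finset.sum_filter]
  congr 1
  ext k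
  simp only [Finset.mem_filter, Finset.mem_Icc, abs_le]
  omega

/-- With `G = geomKernel n t` and `z = e^{int}`, the right side is `|G + z|² - |G|²`; summation over
the order therefore telescopes to `|G|²`. -/
lemma dirichletKernel_succ_sum (n : ℕ) (t : Circ) :
    dirichletKernel n t
      = 1 + geomKernel n t * conj (fourier (n : ℤ) t) + conj (geomKernel n t) * fourier (n : ℤ) t := by
  have h1 : geomKernel n t * conj (fourier (n : ℤ) t)
      = ∑ l ∈ Finset.range n, fourier (-((l : ℤ) + 1)) t := by
    rw [geomKernel, Finset.sum_mul, ← Finset.sum_range_reflect]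
    refine Finset.sum_congr rfl fun k hk => ?_
    rw [Finset.mem_range] at hk
    rw [← fourier_neg, ← fourier_add]
    congr 2
    omega
  have h2 : conj (geomKernel n t) * fourier (n : ℤ) t
      = ∑ l ∈ Finset.range n, fourier ((l : ℤ) + 1) t := by
    have := congrArg conj h1
    rw [map_mul, Complex.conj_conj, map_sum] at this
    rw [this]
    refine Finset.sum_congr rfl fun k hk => ?_
    rw [← fourier_neg, neg_neg]
  rw [h1, h2]
  clear h1 h2
  induction n with
  | zero => simp [dirichletKernel]
  | succ n ih =>
    have : dirichletKernel (n + 1) t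
        = dirichletKernel n t + fourier (-((n : ℤ) + 1)) t + fourier ((n : ℤ) + 1) t := by
      unfold dirichletKernel
      have e : Finset.Icc (-((n + 1 : ℕ) : ℤ)) ((n + 1 : ℕ) : ℤ)
          = insert ((n : ℤ) + 1) (insert (-((n : ℤ) + 1)) (Finset.Icc (-(n : ℤ)) n)) := by
        ext k; simp only [Finset.mem_Icc, Finset.mem_insert]; push_cast; omega
      rw [e, Finset.sum_insert, Finset.sum_insert]
      · ring
      · simp only [Finset.mem_Icc]; omega
      · simp only [Finset.mem_Icc, Finset.mem_insert]; omega
    rw [this, ih, Finset.sum_range_succ, Finset.sum_range_succ]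
    ring

lemma sum_dirichletKernel (n : ℕ) (t : Circ) :
    ∑ r ∈ Finset.range n, dirichletKernel r t = ((‖geomKernel n t‖ ^ 2 : ℝ) : ℂ) := by
  induction n with
  | zero => simp [geomKernel]
  | succ n ih =>
    rw [Finset.sum_range_succ, ih, dirichletKernel_succ_sum]
    have h : geomKernel (n + 1) t = geomKernel n t + fourier (n : ℤ) t := by
      rw [geomKernel, Finset.sum_range_succ, ← geomKernel]
    have h1 : fourier (n : ℤ) t * conj (fourier (n : ℤ) t) = 1 := by
      rw [Complex.mul_conj', norm_fourier_apply]; simp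
    push_cast
    rw [← Complex.mul_conj', ← Complex.mul_conj', h, map_add]
    linear_combination -h1

lemma sum_fejerWeight_mul_fourier {p R : ℕ} (h : p ≤ R) (t : Circ) :
    ∑ k ∈ Finset.Icc (-(R : ℤ)) R, (fejerWeight p k : ℂ) * fourier k t = (fejerKernel p t : ℂ) := by
  have h1 : ((p : ℂ) + 1) ≠ 0 := by exact_mod_cast Nat.succ_ne_zero p
  refine mul_left_cancel₀ h1 ?_
  have h2 : ((p : ℂ) + 1) * (fejerKernel p t : ℂ) = ((‖geomKernel (p + 1) t‖ ^ 2 : ℝ) : ℂ) := by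
    unfold fejerKernel; push_cast; field_simp
  rw [h2, ← sum_dirichletKernel, Finset.mul_sum]
  have h3 : ∀ k : ℤ, ((p : ℂ) + 1) * ((fejerWeight p k : ℂ) * fourier k t)
      = ∑ r ∈ Finset.range (p + 1), ((if |k| ≤ (r : ℤ) then (1 : ℝ) else 0 : ℝ) : ℂ) * fourier k t := by
    intro k
    rw [← Finset.sum_mul, ← Complex.ofReal_sum, sum_range_ite_abs_le]
    push_cast; ring
  simp only [h3]
  rw [Finset.sum_comm]
  refine Finset.sum_congr rfl fun r hr => ?_
  rw [dirichletKernel_eq_sum (R := R)]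
  rw [Finset.mem_range] at hr; omega

/-! ### Integrals of the kernels -/

lemma integral_circ_norm (g : ℝ → ℝ) :
    ∫ t : Circ, g ‖t‖ = ∫ t in (-Real.pi)..Real.pi, g |t| := by
  have h := AddCircle.intervalIntegral_preimage (2 * Real.pi) (-Real.pi) (fun t : Circ => g ‖t‖)
  rw [← h]
  have e : -Real.pi + 2 * Real.pi = Real.pi := by ring
  rw [e]
  refine intervalIntegral.integral_congr fun y hy => ?_
  have hπ := Real.pi_pos
  rw [Set.uIcc_of_le (by linarith), Set.mem_Icc] at hy
  have : ‖(y : Circ)‖ = |y| := by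
    rw [AddCircle.norm_coe_eq_abs_iff _ Real.two_pi_pos.ne', abs_of_pos Real.two_pi_pos]
    exact abs_le.2 ⟨by linarith, by linarith⟩
  simp only [this]

lemma integral_fejerMajorant_le (p : ℕ) : ∫ t : Circ, fejerMajorant p t ≤ Real.pi := by
  have h := integral_circ_norm (fun r => ((p : ℝ) + 1) / (1 + (p + 1) ^ 2 * r ^ 2))
  unfold fejerMajorant
  rw [h]
  simp only [sq_abs]
  have hp : (p : ℝ) + 1 ≠ 0 := by positivity
  have e : ∀ x : ℝ, ((p : ℝ) + 1) / (1 + (p + 1) ^ 2 * x ^ 2)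
      = (p + 1) * (1 + ((p + 1) * x) ^ 2)⁻¹ := by
    intro x; rw [mul_pow]; rfl
  simp only [e]
  rw [intervalIntegral.integral_const_mul,
    intervalIntegral.integral_comp_mul_left (fun x => (1 + x ^ 2)⁻¹) hp, integral_inv_one_add_sq,
    smul_eq_mul, ← mul_assoc, mul_inv_cancel₀ hp, one_mul]
  have h1 := Real.arctan_lt_pi_div_two ((p + 1) * Real.pi)
  have h2 := Real.neg_pi_div_two_lt_arctan ((p + 1) * -Real.pi)
  linarith

lemma integral_dirichletMajorant_le : ∃ C : ℝ, 0 ≤ C ∧ ∀ m : ℕ,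
    ∫ t : Circ, dirichletMajorant m t ≤ C * Real.log (m + 2) := by
  have hπ := Real.pi_pos
  -- Each half of the circle contributes `log (1 + (m + 1)π) ≤ 3 log (m + 2)`.
  refine ⟨(2 + Real.pi) * 6, by positivity, fun m => ?_⟩
  have h := integral_circ_norm (fun r => (2 + Real.pi) * (((m : ℝ) + 1) / (1 + (m + 1) * r)))
  unfold dirichletMajorant
  rw [h, intervalIntegral.integral_const_mul, mul_assoc]
  refine mul_le_mul_of_nonneg_left ?_ (by positivity)
  have hm : (0 : ℝ) < m + 1 := by positivity
  have hc : Continuous fun x : ℝ => ((m : ℝ) + 1) / (1 + (m + 1) * |x|) :=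
    continuous_const.div (by fun_prop) fun t => by positivity
  have hpos : ∫ x in (0 : ℝ)..Real.pi, ((m : ℝ) + 1) / (1 + (m + 1) * |x|)
      = Real.log (1 + (m + 1) * Real.pi) := by
    have hd : ∀ x ∈ Set.uIcc 0 Real.pi, HasDerivAt (fun x : ℝ => Real.log (1 + (m + 1) * x))
        (((m : ℝ) + 1) / (1 + (m + 1) * |x|)) x := by
      intro x hx
      rw [Set.uIcc_of_le hπ.le, Set.mem_Icc] at hx
      rw [abs_of_nonneg hx.1]
      have : HasDerivAt (fun x : ℝ => 1 + ((m : ℝ) + 1) * x) (m + 1) x := by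
        simpa using ((hasDerivAt_id x).const_mul ((m : ℝ) + 1)).const_add 1
      refine this.log ?_
      have := hx.1
      positivity
    rw [intervalIntegral.integral_eq_sub_of_hasDerivAt hd (hc.intervalIntegrable _ _)]
    simp
  have hneg : ∫ x in (-Real.pi)..0, ((m : ℝ) + 1) / (1 + (m + 1) * |x|)
      = Real.log (1 + (m + 1) * Real.pi) := by
    rw [← hpos]
    have := intervalIntegral.integral_comp_neg (a := 0) (b := Real.pi)
      (fun x : ℝ => ((m : ℝ) + 1) / (1 + (m + 1) * |x|))
    simp only [abs_neg, neg_zero] at this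
    exact this.symm
  rw [← intervalIntegral.integral_add_adjacent_intervals (hc.intervalIntegrable (-Real.pi) 0)
    (hc.intervalIntegrable 0 Real.pi), hpos, hneg]
  have h1 : Real.log (1 + (m + 1) * Real.pi) ≤ Real.log (((m : ℝ) + 2) ^ 3) := by
    refine Real.log_le_log (by positivity) ?_
    have := Real.pi_le_four
    have hm0 : (0 : ℝ) ≤ m := by positivity
    nlinarith [mul_nonneg hm0 hm0, mul_nonneg (mul_nonneg hm0 hm0) hm0]
  rw [Real.log_pow] at h1
  push_cast at h1
  linarith

lemma integral_fourier_circ (k : ℤ) :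
    ∫ t : Circ, fourier k t = if k = 0 then ((2 * Real.pi : ℝ) : ℂ) else 0 := by
  split_ifs with h
  · subst h
    simp only [fourier_zero]
    rw [integral_const, Complex.real_smul, mul_one, measureReal_def, AddCircle.measure_univ,
      ENNReal.toReal_ofReal Real.two_pi_pos.le]
  -- Translation by `π / k` changes the sign of `e^{ikt}` and preserves the integral.
  · have h1 := integral_add_right_eq_self (μ := (volume : Measure Circ)) (fun t => fourier k t)
      (((2 * Real.pi) / 2 / k : ℝ) : Circ)
    simp only [fourier_add_half_inv_index h Real.two_pi_pos, integral_neg] at h1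
    exact self_eq_neg.1 h1.symm

lemma integral_fejerKernel_mul_fourier (p : ℕ) (k : ℤ) :
    ∫ t : Circ, (fejerKernel p t : ℂ) * fourier k t = 2 * Real.pi * fejerWeight p k := by
  -- The range is enlarged to `p + |k|` so that it always contains `-k`, the only frequency
  -- surviving the integration.
  have h : ∀ t : Circ, (fejerKernel p t : ℂ) * fourier k t
      = ∑ l ∈ Finset.Icc (-((p + k.natAbs : ℕ) : ℤ)) (p + k.natAbs : ℕ),
        (fejerWeight p l : ℂ) * fourier (l + k) t := by
    intro t
    rw [← sum_fejerWeight_mul_fourier (le_add_right le_rfl : p ≤ p + k.natAbs), Finset.sum_mul]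
    refine Finset.sum_congr rfl fun l _ => ?_
    rw [fourier_add, mul_assoc]
  simp only [h]
  rw [integral_finsetSum]
  · simp only [integral_const_mul, integral_fourier_circ]
    rw [Finset.sum_eq_single (-k)]
    · have : fejerWeight p (-k) = fejerWeight p k := by simp [fejerWeight]
      simp [this]; ring
    · intro b _ hb
      have : b + k ≠ 0 := by omega
      simp [this]
    · intro h; exact absurd (Finset.mem_Icc.2 ⟨by omega, by omega⟩) h
  · intro l _
    exact ((fourier (l + k)).continuous.const_mul _).integrable_of_hasCompactSupport
      (HasCompactSupport.of_compactSpace _)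

lemma lintegral_fejerMajorant_le (p : ℕ) :
    ∫⁻ t : Circ, ENNReal.ofReal (fejerMajorant p t) ≤ ENNReal.ofReal Real.pi := by
  rw [← ofReal_integral_eq_lintegral_ofReal]
  · exact ENNReal.ofReal_le_ofReal (integral_fejerMajorant_le p)
  · exact (continuous_fejerMajorant p).integrable_of_hasCompactSupport
      (HasCompactSupport.of_compactSpace _)
  · exact Filter.Eventually.of_forall (fejerMajorant_nonneg p)

/-- Since `‖u‖ ≤ ‖t‖ + ‖t - u‖`, one of `t`, `t - u` has norm at least `‖u‖ / 2`; the majorant at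
that point costs at most `4` times its value at `u`. -/
lemma fejerMajorant_mul_le (p q : ℕ) (t u : Circ) :
    fejerMajorant p t * fejerMajorant q (t - u) ≤
      4 * (fejerMajorant p u * fejerMajorant q (t - u) + fejerMajorant q u * fejerMajorant p t) := by
  have hp := fejerMajorant_nonneg p
  have hq := fejerMajorant_nonneg q
  have htri : ‖u‖ ≤ ‖t‖ + ‖t - u‖ := by
    have := norm_sub_le t (t - u)
    simpa using this
  rcases le_total ‖t‖ ‖t - u‖ with h | h
  · have := fejerMajorant_le_of_norm_le q (s := t - u) (t := u) (by linarith)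
    nlinarith [mul_le_mul_of_nonneg_left this (hp t), mul_nonneg (hp u) (hq (t - u))]
  · have := fejerMajorant_le_of_norm_le p (s := t) (t := u) (by linarith)
    nlinarith [mul_le_mul_of_nonneg_right this (hq (t - u)), mul_nonneg (hq u) (hp t)]

/-- The convolution of two Fejér majorants is dominated by their sum. -/
lemma lintegral_fejerMajorant_mul_le (p q : ℕ) (u : Circ) :
    ∫⁻ t : Circ, ENNReal.ofReal (fejerMajorant p t) * ENNReal.ofReal (fejerMajorant q (t - u)) ≤
      4 * ENNReal.ofReal Real.pi *
        (ENNReal.ofReal (fejerMajorant p u) + ENNReal.ofReal (fejerMajorant q u)) := by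
  have hm : ∀ p, Measurable fun t : Circ => ENNReal.ofReal (fejerMajorant p t) := fun p =>
    (continuous_fejerMajorant p).measurable.ennreal_ofReal
  have h : ∀ t : Circ, ENNReal.ofReal (fejerMajorant p t) * ENNReal.ofReal (fejerMajorant q (t - u))
      ≤ 4 * (ENNReal.ofReal (fejerMajorant p u) * ENNReal.ofReal (fejerMajorant q (t - u))
        + ENNReal.ofReal (fejerMajorant q u) * ENNReal.ofReal (fejerMajorant p t)) := by
    intro t
    have hp := fejerMajorant_nonneg p
    have hq := fejerMajorant_nonneg q
    rw [← ENNReal.ofReal_mul (hp _), ← ENNReal.ofReal_mul (hp _), ← ENNReal.ofReal_mul (hq _),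
      ← ENNReal.ofReal_add (mul_nonneg (hp _) (hq _)) (mul_nonneg (hq _) (hp _))]
    have : (4 : ℝ≥0∞) = ENNReal.ofReal 4 := by simp
    rw [this, ← ENNReal.ofReal_mul (by norm_num)]
    exact ENNReal.ofReal_le_ofReal (fejerMajorant_mul_le p q t u)
  refine (lintegral_mono h).trans ?_
  have hmq : Measurable fun t : Circ => ENNReal.ofReal (fejerMajorant q (t - u)) :=
    (hm q).comp (measurable_id.sub_const u)
  rw [lintegral_const_mul' _ _ (by norm_num),
    lintegral_add_left (hmq.const_mul _), lintegral_const_mul _ hmq,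
    lintegral_const_mul _ (hm p),
    lintegral_sub_right_eq_self (fun t : Circ => ENNReal.ofReal (fejerMajorant q t)) u]
  have h1 := lintegral_fejerMajorant_le p
  have h2 := lintegral_fejerMajorant_le q
  rw [mul_assoc, mul_add (ENNReal.ofReal Real.pi), mul_comm (ENNReal.ofReal Real.pi),
    mul_comm (ENNReal.ofReal Real.pi)]
  gcongr

/-! ### Suprema of families and measurable selections -/

section Selection

variable {X ι : Type*} [MeasurableSpace X]

lemma measurable_comp_selection {Y γ : Type*} [MeasurableSpace Y] [MeasurableSpace γ]
    [MeasurableSpace ι] [DiscreteMeasurableSpace ι] [Countable ι] {f : ι → X → γ}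
    (hf : ∀ i, Measurable (f i)) {k : Y → ι} {z : Y → X} (hk : Measurable k) (hz : Measurable z) :
    Measurable fun y => f (k y) (z y) := by
  have h : Measurable fun q : ι × X => f q.1 q.2 := measurable_from_prod_countable_right hf
  exact h.comp (hk.prodMk hz)

/-- A finite family of measurable functions attains its maximum along a measurable selection. -/
lemma exists_measurable_selection [MeasurableSpace ι] [DiscreteMeasurableSpace ι] [Countable ι]
    (U : ι → X → ℝ≥0∞) (hU : ∀ i, Measurable (U i)) (S : Finset ι) (hS : S.Nonempty) :
    ∃ κ : X → ι, Measurable κ ∧ (∀ x, κ x ∈ S) ∧ ∀ x, ∀ i ∈ S, U i x ≤ U (κ x) x := by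
  classical
  induction hS using Finset.Nonempty.cons_induction with
  | singleton a =>
    exact ⟨fun _ => a, measurable_const, fun _ => by simp, fun x i hi => by
      rw [Finset.mem_singleton.1 hi]⟩
  | cons a S ha hS ih =>
    obtain ⟨κ, hκ, hmem, hmax⟩ := ih
    have hUκ : Measurable fun x => U (κ x) x := measurable_comp_selection hU hκ measurable_id
    refine ⟨fun x => if U (κ x) x ≤ U a x then a else κ x,
      Measurable.ite (measurableSet_le hUκ (hU a)) measurable_const hκ, fun x => ?_,
      fun x i hi => ?_⟩
    · dsimp only
      split_ifs
      · simp
      · exact Finset.mem_cons_of_mem (hmem x)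
    · dsimp only
      split_ifs with h
      · rcases Finset.mem_cons.1 hi with rfl | hi
        · exact le_rfl
        · exact (hmax x i hi).trans h
      · rcases Finset.mem_cons.1 hi with rfl | hi
        · exact (not_le.1 h).le
        · exact hmax x i hi

/-- A bound for the integrals along all measurable selections with finite range bounds the integral
of the supremum. -/
lemma lintegral_iSup_le_of_selection [MeasurableSpace ι] [DiscreteMeasurableSpace ι] [Countable ι]
    (μ : Measure X) (U : ι → X → ℝ≥0∞) (hU : ∀ i, Measurable (U i)) (B : ℝ≥0∞)
    (h : ∀ (S : Finset ι) (κ : X → ι), Measurable κ → (∀ x, κ x ∈ S) →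
      ∫⁻ x, U (κ x) x ∂μ ≤ B) :
    ∫⁻ x, ⨆ i, U i x ∂μ ≤ B := by
  classical
  have e : ∀ x, ⨆ i, U i x = ⨆ S : Finset ι, ⨆ i ∈ S, U i x := fun x => iSup_eq_iSup_finset _
  simp only [e]
  -- The suprema over finite index sets form a countable directed family, so monotone convergence
  -- leaves only finite maxima, which are attained along a selection.
  rw [lintegral_iSup_directed]
  · refine iSup_le fun S => ?_
    rcases S.eq_empty_or_nonempty with rfl | hS
    · simp
    · obtain ⟨κ, hκ, hmem, hmax⟩ := exists_measurable_selection U hU S hS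
      refine le_trans (lintegral_mono fun x => ?_) (h S κ hκ hmem)
      exact iSup₂_le (hmax x)
  · intro S
    exact (Measurable.biSup (S : Set ι) S.countable_toSet fun i _ => hU i).aemeasurable
  · intro S S'
    refine ⟨S ∪ S', fun x => ?_, fun x => ?_⟩
    · exact biSup_mono fun i hi => Finset.mem_union_left _ hi
    · exact biSup_mono fun i hi => Finset.mem_union_right _ hi

lemma lintegral_mul_sq_le (μ : Measure X) {f g : X → ℝ≥0∞} (hf : AEMeasurable f μ)
    (hg : AEMeasurable g μ) :
    (∫⁻ x, f x * g x ∂μ) ^ 2 ≤ (∫⁻ x, f x ^ 2 ∂μ) * ∫⁻ x, g x ^ 2 ∂μ := by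
  have h := ENNReal.lintegral_mul_le_Lp_mul_Lq μ Real.HolderConjugate.two_two hf hg
  simp only [Pi.mul_apply] at h
  have h2 := pow_le_pow_left₀ (zero_le) h 2
  rw [mul_pow, ← ENNReal.rpow_natCast, ← ENNReal.rpow_natCast, ← ENNReal.rpow_natCast,
    ← ENNReal.rpow_mul, ← ENNReal.rpow_mul] at h2
  norm_num at h2
  simpa using h2

end Selection

/-! ### A maximal theorem for self-reproducing kernels -/

section KernelMaximal

set_option linter.unusedSectionVars false

variable {X K : Type*} [AddCommGroup X] [MeasurableSpace X] [MeasurableAdd₂ X] [MeasurableSub₂ X]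
  [AddCommGroup K] [MeasurableSpace K] [MeasurableAdd₂ K] [MeasurableSub₂ K] [MeasurableNeg K]

/-- The average of `h` along the orbits of `e : K →+ X` against the kernel of order `κ x`. -/
noncomputable def kernelAverage (ρ : Measure K) (e : K →+ X) (φ : ℕ → K → ℝ≥0∞) (κ : X → ℕ)
    (h : X → ℝ≥0∞) (x : X) : ℝ≥0∞ :=
  ∫⁻ t, φ (κ x) t * h (x + e t) ∂ρ

/-- The adjoint of `kernelAverage`. -/
noncomputable def kernelAdjoint (ρ : Measure K) (e : K →+ X) (φ : ℕ → K → ℝ≥0∞) (κ : X → ℕ)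
    (g : X → ℝ≥0∞) (y : X) : ℝ≥0∞ :=
  ∫⁻ t, φ (κ (y - e t)) t * g (y - e t) ∂ρ

variable {μ : Measure X} [SFinite μ] [μ.IsAddRightInvariant]
  {ρ : Measure K} [SFinite ρ] [ρ.IsAddLeftInvariant] [ρ.IsNegInvariant]
  {e : K →+ X} {φ : ℕ → K → ℝ≥0∞} {κ : X → ℕ} {g h : X → ℝ≥0∞}

lemma measurable_kernelAverage (hφ : ∀ p, Measurable (φ p)) (he : Measurable e)
    (hκ : Measurable κ) (hh : Measurable h) : Measurable (kernelAverage ρ e φ κ h) := by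
  refine Measurable.lintegral_prod_right' (f := fun q : X × K => φ (κ q.1) q.2 * h (q.1 + e q.2)) ?_
  exact (measurable_comp_selection hφ (by fun_prop) measurable_snd).mul (by fun_prop)

lemma measurable_kernelAdjoint (hφ : ∀ p, Measurable (φ p)) (he : Measurable e)
    (hκ : Measurable κ) (hg : Measurable g) : Measurable (kernelAdjoint ρ e φ κ g) := by
  refine Measurable.lintegral_prod_right' (f := fun q : X × K =>
    φ (κ (q.1 - e q.2)) q.2 * g (q.1 - e q.2)) ?_
  exact (measurable_comp_selection hφ (by fun_prop) measurable_snd).mul (by fun_prop)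

/-- Tonelli and the translation `x = y - e t`, under which `μ` is invariant. -/
lemma lintegral_kernelAverage_mul (hφ : ∀ p, Measurable (φ p)) (he : Measurable e)
    (hκ : Measurable κ) (hg : Measurable g) (hh : Measurable h) :
    ∫⁻ x, kernelAverage ρ e φ κ h x * g x ∂μ = ∫⁻ y, h y * kernelAdjoint ρ e φ κ g y ∂μ := by
  have hw : Measurable fun q : X × K => φ (κ q.1) q.2 :=
    measurable_comp_selection hφ (by fun_prop) measurable_snd
  have hw' : Measurable fun q : X × K => φ (κ (q.1 - e q.2)) q.2 :=
    measurable_comp_selection hφ (by fun_prop) measurable_snd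
  have hadd : Measurable fun q : X × K => h (q.1 + e q.2) := by fun_prop
  have hsub : Measurable fun q : X × K => g (q.1 - e q.2) := by fun_prop
  have h1 : ∀ x, kernelAverage ρ e φ κ h x * g x = ∫⁻ t, φ (κ x) t * h (x + e t) * g x ∂ρ :=
    fun x => by
      have hm : Measurable fun t => φ (κ x) t * h (x + e t) :=
        (hw.mul hadd).comp (measurable_const.prodMk measurable_id)
      rw [kernelAverage, lintegral_mul_const _ hm]
  have h2 : ∀ y, h y * kernelAdjoint ρ e φ κ g y
      = ∫⁻ t, h y * (φ (κ (y - e t)) t * g (y - e t)) ∂ρ := fun y => by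
    have hm : Measurable fun t => φ (κ (y - e t)) t * g (y - e t) :=
      (hw'.mul hsub).comp (measurable_const.prodMk measurable_id)
    rw [kernelAdjoint, lintegral_const_mul _ hm]
  have hm1 : Measurable (Function.uncurry fun x t => φ (κ x) t * h (x + e t) * g x) :=
    (hw.mul hadd).mul (hg.comp measurable_fst)
  have hm2 : Measurable (Function.uncurry fun y t => h y * (φ (κ (y - e t)) t * g (y - e t))) :=
    (hh.comp measurable_fst).mul (hw'.mul hsub)
  simp only [h1, h2]
  rw [lintegral_lintegral_swap hm1.aemeasurable, lintegral_lintegral_swap hm2.aemeasurable]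
  refine lintegral_congr fun t => ?_
  rw [← lintegral_sub_right_eq_self (fun x => φ (κ x) t * h (x + e t) * g x) (e t)]
  refine lintegral_congr fun y => ?_
  rw [sub_add_cancel]; ring

/-- In the coordinate `u` along the orbit of `x`, the adjoint is an integral operator whose order is
chosen at the integration point; this puts the composite kernel in convolution form. -/
lemma kernelAdjoint_add (x : X) (t : K) :
    kernelAdjoint ρ e φ κ g (x + e t)
      = ∫⁻ u, φ (κ (x + e u)) (t - u) * g (x + e u) ∂ρ := by
  rw [kernelAdjoint, ← lintegral_sub_left_eq_self _ t]
  refine lintegral_congr fun u => ?_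
  have : x + e t - e (t - u) = x + e u := by rw [map_sub]; abel
  rw [this]

lemma kernelAdjoint_eq (hneg : ∀ p t, φ p (-t) = φ p t) (x : X) :
    kernelAdjoint ρ e φ κ g x = ∫⁻ u, φ (κ (x + e u)) u * g (x + e u) ∂ρ := by
  have := kernelAdjoint_add (ρ := ρ) (e := e) (φ := φ) (κ := κ) (g := g) x 0
  simpa only [map_zero, add_zero, zero_sub, hneg] using this

/-- The composition of `kernelAverage` with its adjoint is dominated by their sum. -/
lemma kernelAverage_kernelAdjoint_le (hφ : ∀ p, Measurable (φ p)) (he : Measurable e)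
    (hneg : ∀ p t, φ p (-t) = φ p t) {c : ℝ≥0}
    (hc : ∀ p q u, ∫⁻ t, φ p t * φ q (t - u) ∂ρ ≤ c * (φ p u + φ q u))
    (hκ : Measurable κ) (hg : Measurable g) (x : X) :
    kernelAverage ρ e φ κ (kernelAdjoint ρ e φ κ g) x ≤
      c * (kernelAverage ρ e φ κ g x + kernelAdjoint ρ e φ κ g x) := by
  have hm1 : Measurable fun q : K × K => φ (κ x) q.1 := (hφ _).comp measurable_fst
  have hm2 : Measurable fun q : K × K => φ (κ (x + e q.2)) (q.1 - q.2) :=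
    measurable_comp_selection hφ (by fun_prop) (measurable_fst.sub measurable_snd)
  have hm3 : Measurable fun q : K × K => g (x + e q.2) := by fun_prop
  have h1 : kernelAverage ρ e φ κ (kernelAdjoint ρ e φ κ g) x
      = ∫⁻ t, ∫⁻ u, φ (κ x) t * (φ (κ (x + e u)) (t - u) * g (x + e u)) ∂ρ ∂ρ := by
    rw [kernelAverage]
    refine lintegral_congr fun t => ?_
    have hm : Measurable fun u => φ (κ (x + e u)) (t - u) * g (x + e u) :=
      (hm2.mul hm3).comp (measurable_const.prodMk measurable_id)
    rw [kernelAdjoint_add, lintegral_const_mul _ hm]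
  have hA : Measurable fun u => φ (κ x) u * g (x + e u) := (hφ _).mul (by fun_prop)
  have hm4 : Measurable (Function.uncurry fun t u =>
      φ (κ x) t * (φ (κ (x + e u)) (t - u) * g (x + e u))) := hm1.mul (hm2.mul hm3)
  -- After the swap both orders, `κ x` and `κ (x + e u)`, are constant in the inner variable `t`, so
  -- `hc` applies.
  rw [h1, lintegral_lintegral_swap hm4.aemeasurable, kernelAdjoint_eq hneg,
    kernelAverage, ← lintegral_add_left hA, ← lintegral_const_mul' _ _ (by finiteness)]
  refine lintegral_mono fun u => ?_
  have h2 : ∀ t, φ (κ x) t * (φ (κ (x + e u)) (t - u) * g (x + e u))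
      = φ (κ x) t * φ (κ (x + e u)) (t - u) * g (x + e u) := fun t => by ring
  have hm5 : Measurable fun t => φ (κ x) t * φ (κ (x + e u)) (t - u) :=
    (hm1.mul hm2).comp (measurable_id.prodMk measurable_const)
  simp only [h2]
  rw [lintegral_mul_const _ hm5]
  refine (mul_le_mul_left (hc _ _ _) _).trans (le_of_eq ?_)
  ring

/-- With `T` the averaging operator: `‖T*g‖² = ⟨T T*g, g⟩ ≤ c (⟨Tg, g⟩ + ⟨T*g, g⟩) = 2c ⟨Tg, g⟩`. -/
lemma lintegral_kernelAdjoint_sq_le (hφ : ∀ p, Measurable (φ p)) (he : Measurable e)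
    (hneg : ∀ p t, φ p (-t) = φ p t) {c : ℝ≥0}
    (hc : ∀ p q u, ∫⁻ t, φ p t * φ q (t - u) ∂ρ ≤ c * (φ p u + φ q u))
    (hκ : Measurable κ) (hg : Measurable g) :
    ∫⁻ x, kernelAdjoint ρ e φ κ g x ^ 2 ∂μ ≤
      2 * c * ∫⁻ x, kernelAverage ρ e φ κ g x * g x ∂μ := by
  have hadj : Measurable (kernelAdjoint ρ e φ κ g) := measurable_kernelAdjoint hφ he hκ hg
  have havg : Measurable (kernelAverage ρ e φ κ g) := measurable_kernelAverage hφ he hκ hg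
  simp only [sq]
  rw [← lintegral_kernelAverage_mul hφ he hκ hg hadj]
  refine (lintegral_mono fun x => mul_le_mul_left
    (kernelAverage_kernelAdjoint_le hφ he hneg hc hκ hg x) (g x)).trans (le_of_eq ?_)
  have : ∀ x, c * (kernelAverage ρ e φ κ g x + kernelAdjoint ρ e φ κ g x) * g x
      = c * (kernelAverage ρ e φ κ g x * g x + g x * kernelAdjoint ρ e φ κ g x) :=
    fun x => by ring
  have hm : Measurable fun x => kernelAverage ρ e φ κ g x * g x := havg.mul hg
  simp only [this]
  rw [lintegral_const_mul' _ _ (by finiteness), lintegral_add_left hm,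
    ← lintegral_kernelAverage_mul hφ he hκ hg hg]
  ring

/-- A crude bound for `kernelAverage`, depending on the order. -/
lemma lintegral_kernelAverage_sq_le_crude [IsFiniteMeasure ρ] (he : Measurable e) {b : ℝ≥0}
    (hb : ∀ x t, φ (κ x) t ≤ b) (hh : Measurable h) :
    ∫⁻ x, kernelAverage ρ e φ κ h x ^ 2 ∂μ ≤ (b * ρ Set.univ) ^ 2 * ∫⁻ x, h x ^ 2 ∂μ := by
  have h1 : ∀ x, kernelAverage ρ e φ κ h x ^ 2 ≤
      b ^ 2 * (ρ Set.univ * ∫⁻ t, h (x + e t) ^ 2 ∂ρ) := by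
    intro x
    have hx : Measurable fun t => h (x + e t) := by fun_prop
    have h2 : kernelAverage ρ e φ κ h x ≤ b * ∫⁻ t, 1 * h (x + e t) ∂ρ := by
      rw [kernelAverage, ← lintegral_const_mul' _ _ (by finiteness)]
      refine lintegral_mono fun t => ?_
      rw [one_mul]
      exact mul_le_mul_left (hb x t) _
    refine (pow_le_pow_left₀ zero_le h2 2).trans ?_
    rw [mul_pow]
    refine mul_le_mul_right ((lintegral_mul_sq_le ρ aemeasurable_const
      hx.aemeasurable).trans (le_of_eq ?_)) _
    simp
  have hm : Measurable (Function.uncurry fun x t => h (x + e t) ^ 2) := by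
    unfold Function.uncurry
    fun_prop
  refine (lintegral_mono h1).trans (le_of_eq ?_)
  rw [lintegral_const_mul' _ _ (by finiteness), lintegral_const_mul' _ _ (by finiteness),
    lintegral_lintegral_swap hm.aemeasurable]
  have : ∀ t, ∫⁻ x, h (x + e t) ^ 2 ∂μ = ∫⁻ x, h x ^ 2 ∂μ := fun t =>
    lintegral_add_right_eq_self (fun x => h x ^ 2) (e t)
  simp only [this]
  rw [lintegral_const]
  ring

lemma ENNReal.le_of_sq_le_mul {a b : ℝ≥0∞} (ha : a ≠ ∞) (h : a ^ 2 ≤ b * a) : a ≤ b := by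
  rcases eq_or_ne a 0 with rfl | h0
  · exact zero_le
  · rw [sq] at h
    exact (ENNReal.mul_le_mul_iff_left h0 ha).1 h

/-- The `L²` bound of `kernelAverage` improves itself. -/
lemma lintegral_kernelAverage_sq_le_improve (hφ : ∀ p, Measurable (φ p)) (he : Measurable e)
    (hneg : ∀ p t, φ p (-t) = φ p t) {c : ℝ≥0}
    (hc : ∀ p q u, ∫⁻ t, φ p t * φ q (t - u) ∂ρ ≤ c * (φ p u + φ q u))
    (hκ : Measurable κ) (A : ℝ≥0)
    (hA : ∀ h : X → ℝ≥0∞, Measurable h →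
      ∫⁻ x, h x ^ 2 ∂μ ≠ ∞ →
      ∫⁻ x, kernelAverage ρ e φ κ h x ^ 2 ∂μ ≤ (A : ℝ≥0∞) ^ 2 * ∫⁻ x, h x ^ 2 ∂μ)
    (hh : Measurable h) (htop : ∫⁻ x, h x ^ 2 ∂μ ≠ ∞) :
    ∫⁻ x, kernelAverage ρ e φ κ h x ^ 2 ∂μ ≤ 2 * c * A * ∫⁻ x, h x ^ 2 ∂μ := by
  set g := kernelAverage ρ e φ κ h with hg_def
  have hg : Measurable g := measurable_kernelAverage hφ he hκ hh
  have hfin : ∫⁻ x, g x ^ 2 ∂μ ≠ ∞ := ne_top_of_le_ne_top (by finiteness) (hA h hh htop)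
  have hav : Measurable (kernelAverage ρ e φ κ g) := measurable_kernelAverage hφ he hκ hg
  have had : Measurable (kernelAdjoint ρ e φ κ g) := measurable_kernelAdjoint hφ he hκ hg
  refine ENNReal.le_of_sq_le_mul hfin ?_
  have h1 : (∫⁻ x, kernelAverage ρ e φ κ g x * g x ∂μ) ≤ A * ∫⁻ x, g x ^ 2 ∂μ := by
    have := lintegral_mul_sq_le μ hav.aemeasurable hg.aemeasurable
    refine (ENNReal.pow_le_pow_left_iff two_ne_zero).1 ?_
    refine this.trans ((mul_le_mul_left (hA g hg hfin) _).trans (le_of_eq ?_))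
    ring
  -- For `g = T h`: `‖g‖⁴ = ⟨h, T*g⟩² ≤ ‖h‖² ‖T*g‖² ≤ ‖h‖² · 2c ⟨Tg, g⟩ ≤ 2cA ‖h‖² ‖g‖²`; the factor
  -- `‖g‖²`, known to be finite, cancels.
  calc (∫⁻ x, g x ^ 2 ∂μ) ^ 2 = (∫⁻ y, h y * kernelAdjoint ρ e φ κ g y ∂μ) ^ 2 := by
        rw [← lintegral_kernelAverage_mul hφ he hκ hg hh]; simp only [sq, hg_def]
    _ ≤ (∫⁻ x, h x ^ 2 ∂μ) * ∫⁻ x, kernelAdjoint ρ e φ κ g x ^ 2 ∂μ :=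
        lintegral_mul_sq_le _ hh.aemeasurable had.aemeasurable
    _ ≤ (∫⁻ x, h x ^ 2 ∂μ) * (2 * c * (A * ∫⁻ x, g x ^ 2 ∂μ)) :=
        mul_le_mul_right ((lintegral_kernelAdjoint_sq_le hφ he hneg hc hκ hg).trans
          (mul_le_mul_right h1 _)) _
    _ = _ := by ring

/-- The `L²` bound of `kernelAverage`, uniform in the selection of the order. -/
lemma lintegral_kernelAverage_sq_le [IsFiniteMeasure ρ] (hφ : ∀ p, Measurable (φ p))
    (he : Measurable e) (hneg : ∀ p t, φ p (-t) = φ p t) {c : ℝ≥0} (hc0 : 0 < c)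
    (hc : ∀ p q u, ∫⁻ t, φ p t * φ q (t - u) ∂ρ ≤ c * (φ p u + φ q u))
    (hκ : Measurable κ) {b : ℝ≥0} (hb : ∀ x t, φ (κ x) t ≤ b) (hh : Measurable h) :
    ∫⁻ x, kernelAverage ρ e φ κ h x ^ 2 ∂μ ≤ (2 * c) ^ 2 * ∫⁻ x, h x ^ 2 ∂μ := by
  rcases eq_or_ne (∫⁻ x, h x ^ 2 ∂μ) ∞ with htop | htop
  · rw [htop, ENNReal.mul_top]
    · exact le_top
    · simp [hc0.ne']
  -- The set of admissible constants is closed, nonempty by the crude bound, and stable under `A ↦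
  -- √(2cA)`. Its infimum `A₀` thus satisfies `A₀ ≤ √(2cA₀)`, hence `A₀ ≤ 2c`, and the crude bound
  -- leaves no trace.
  set S : Set ℝ≥0 := {A | ∀ h : X → ℝ≥0∞, Measurable h → ∫⁻ x, h x ^ 2 ∂μ ≠ ∞ →
      ∫⁻ x, kernelAverage ρ e φ κ h x ^ 2 ∂μ ≤ (A : ℝ≥0∞) ^ 2 * ∫⁻ x, h x ^ 2 ∂μ} with hS
  have hiter : ∀ A ∈ S, NNReal.sqrt (2 * c * A) ∈ S := by
    intro A hA h hh htop
    have := lintegral_kernelAverage_sq_le_improve hφ he hneg hc hκ A hA hh htop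
    rw [← ENNReal.coe_pow, NNReal.sq_sqrt, ENNReal.coe_mul, ENNReal.coe_mul]
    exact this
  have hne : S.Nonempty := by
    refine ⟨b * (ρ Set.univ).toNNReal, fun h hh _ => ?_⟩
    rw [ENNReal.coe_mul, ENNReal.coe_toNNReal (by finiteness)]
    exact lintegral_kernelAverage_sq_le_crude he hb hh
  have hclosed : IsClosed S := by
    simp only [hS, Set.ofPred_forall]
    refine isClosed_iInter fun h => isClosed_iInter fun _ => isClosed_iInter fun hf => ?_
    refine isClosed_le continuous_const ?_
    refine ENNReal.continuous_mul_const hf |>.comp ?_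
    exact (ENNReal.continuous_pow 2).comp ENNReal.continuous_coe
  have hmem : sInf S ∈ S := hclosed.csInf_mem hne (OrderBot.bddBelow S)
  have hle : sInf S ≤ NNReal.sqrt (2 * c * sInf S) :=
    csInf_le (OrderBot.bddBelow S) (hiter _ hmem)
  have hle2 : sInf S ≤ 2 * c := by
    rw [NNReal.le_sqrt_iff_sq_le, sq] at hle
    rcases eq_or_ne (sInf S) 0 with h0 | h0
    · rw [h0]; exact zero_le
    · exact le_of_mul_le_mul_right hle (pos_iff_ne_zero.2 h0)
  refine (hmem h hh htop).trans ?_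
  refine mul_le_mul_left (pow_le_pow_left₀ zero_le ?_ 2) _
  exact_mod_cast hle2

/-- The maximal theorem for kernels whose convolutions are dominated by their sums. -/
theorem lintegral_iSup_kernel_sq_le [IsFiniteMeasure ρ] (hφ : ∀ p, Measurable (φ p))
    (he : Measurable e) (hneg : ∀ p t, φ p (-t) = φ p t) {c : ℝ≥0} (hc0 : 0 < c)
    (hc : ∀ p q u, ∫⁻ t, φ p t * φ q (t - u) ∂ρ ≤ c * (φ p u + φ q u))
    (b : ℕ → ℝ≥0) (hb : ∀ p t, φ p t ≤ b p) (hh : Measurable h) :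
    ∫⁻ x, ⨆ p, (∫⁻ t, φ p t * h (x + e t) ∂ρ) ^ 2 ∂μ ≤ (2 * c) ^ 2 * ∫⁻ x, h x ^ 2 ∂μ := by
  refine lintegral_iSup_le_of_selection μ _ (fun p => ?_) _ fun S κ hκ hmem => ?_
  · exact (measurable_kernelAverage hφ he (measurable_const (a := p)) hh).pow_const 2
  -- A selection with finite range has bounded kernels; only the existence of this bound matters.
  · have hb' : ∀ x t, φ (κ x) t ≤ (S.sup b : ℝ≥0) := fun x t =>
      (hb _ t).trans (ENNReal.coe_le_coe.2 (Finset.le_sup (f := b) (hmem x)))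
    exact lintegral_kernelAverage_sq_le hφ he hneg hc0 hc hκ hb' hh

end KernelMaximal

/-! ### Maximal bounds for families of multipliers -/

section Multipliers

variable {N : ℕ} {ι : Type*}

/-- The inclusion of the `j`-th coordinate circle into the torus. -/
noncomputable def coordHom (j : Fin N) : Circ →+ Torus N :=
  AddMonoidHom.single (fun _ : Fin N => Circ) j

lemma continuous_coordHom (j : Fin N) : Continuous (coordHom j) :=
  continuous_single (A := fun _ : Fin N => Circ) j

lemma coordHom_apply_same (j : Fin N) (t : Circ) : coordHom j t j = t :=
  Pi.single_eq_same (M := fun _ : Fin N => Circ) j t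

lemma coordHom_apply_of_ne {j k : Fin N} (h : k ≠ j) (t : Circ) : coordHom j t k = 0 :=
  Pi.single_eq_of_ne (M := fun _ : Fin N => Circ) h t

/-- The maximal function of the family `w` of multipliers is bounded on `L²` of the torus. -/
def HasMaximalBound (w : ι → (Fin N → ℤ) → ℝ) : Prop :=
  ∃ B : ℝ≥0, ∀ (s : Finset (Fin N → ℤ)) (c : (Fin N → ℤ) → ℂ),
    ∫⁻ x : Torus N, ⨆ i, ‖∑ ν ∈ s, c ν * w i ν * torusExp ν x‖ₑ ^ 2 ≤ B * ∑ ν ∈ s, ‖c ν‖ₑ ^ 2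

lemma norm_torusExp (ν : Fin N → ℤ) (x : Torus N) : ‖torusExp ν x‖ = 1 := by
  rw [torusExp, norm_prod]
  exact Finset.prod_eq_one fun j _ => norm_fourier_apply _ _

lemma continuous_torusExp (ν : Fin N → ℤ) : Continuous (torusExp ν) := by
  unfold torusExp
  exact continuous_finsetProd _ fun j _ => (fourier (ν j)).continuous.comp (continuous_apply j)

lemma torusExp_add_coordHom (ν : Fin N → ℤ) (x : Torus N) (j : Fin N) (t : Circ) :
    torusExp ν (x + coordHom j t) = torusExp ν x * fourier (ν j) t := by
  classical
  have h : ∀ k, fourier (ν k) ((x + coordHom j t : Torus N) k)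
      = fourier (ν k) (x k) * if k = j then fourier (ν j) t else 1 := by
    intro k
    rw [Pi.add_apply]
    split_ifs with hk
    · subst hk
      rw [coordHom_apply_same]
      simp only [fourier_apply, smul_add, AddCircle.toCircle_add, Circle.coe_mul]
    · rw [coordHom_apply_of_ne hk, add_zero, mul_one]
  unfold torusExp
  simp only [h, Finset.prod_mul_distrib, Finset.prod_ite_eq', Finset.mem_univ, if_true]

lemma continuous_trigSum (s : Finset (Fin N → ℤ)) (b : (Fin N → ℤ) → ℂ) :
    Continuous fun x : Torus N => ∑ ν ∈ s, b ν * torusExp ν x :=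
  continuous_finsetSum _ fun ν _ => continuous_const.mul (continuous_torusExp ν)

lemma measurable_enorm_trigSum (s : Finset (Fin N → ℤ)) (b : (Fin N → ℤ) → ℂ) :
    Measurable fun x : Torus N => ‖∑ ν ∈ s, b ν * torusExp ν x‖ₑ :=
  (continuous_trigSum s b).measurable.enorm

/-- The Fejér maximal theorem in one coordinate of the torus. -/
lemma lintegral_iSup_fejerMajorant_sq_le (j : Fin N) {H : Torus N → ℝ≥0∞} (hH : Measurable H) :
    ∫⁻ x, ⨆ p, (∫⁻ t : Circ, ENNReal.ofReal (fejerMajorant p t) * H (x + coordHom j t)) ^ 2 ≤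
      (2 * (4 * Real.pi.toNNReal : ℝ≥0)) ^ 2 * ∫⁻ x, H x ^ 2 := by
  have hπ := Real.pi_pos
  refine lintegral_iSup_kernel_sq_le (μ := (volume : Measure (Torus N)))
    (ρ := (volume : Measure Circ)) (e := coordHom j)
    (φ := fun p t => ENNReal.ofReal (fejerMajorant p t)) ?_ ?_ ?_ ?_ ?_
    (fun p => (p + 1 : ℝ).toNNReal) ?_ hH
  · exact fun p => (continuous_fejerMajorant p).measurable.ennreal_ofReal
  · exact (continuous_coordHom j).measurable
  · exact fun p t => by rw [fejerMajorant_neg]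
  · positivity
  · intro p q u
    refine (lintegral_fejerMajorant_mul_le p q u).trans (le_of_eq ?_)
    rw [ENNReal.coe_mul]; rfl
  · exact fun p t => ENNReal.ofReal_le_ofReal (fejerMajorant_le p t)

/-- The Fejér weight acts as convolution with the Fejér kernel along the `j`-th circle; `2π` appears
because the measure is not normalized. -/
lemma trigSum_fejerWeight (s : Finset (Fin N → ℤ)) (b : (Fin N → ℤ) → ℂ) (p : ℕ) (j : Fin N)
    (x : Torus N) :
    2 * Real.pi * ∑ ν ∈ s, b ν * fejerWeight p (ν j) * torusExp ν x
      = ∫ t : Circ, (fejerKernel p t : ℂ) * ∑ ν ∈ s, b ν * torusExp ν (x + coordHom j t) := by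
  have h : ∀ t : Circ, (fejerKernel p t : ℂ) * ∑ ν ∈ s, b ν * torusExp ν (x + coordHom j t)
      = ∑ ν ∈ s, (b ν * torusExp ν x) * ((fejerKernel p t : ℂ) * fourier (ν j) t) := by
    intro t
    rw [Finset.mul_sum]
    refine Finset.sum_congr rfl fun ν _ => ?_
    rw [torusExp_add_coordHom]; ring
  simp only [h]
  rw [integral_finsetSum]
  · simp only [integral_const_mul, integral_fejerKernel_mul_fourier]
    rw [Finset.mul_sum]
    refine Finset.sum_congr rfl fun ν _ => ?_
    ring
  · intro ν _
    refine Continuous.integrable_of_hasCompactSupport ?_ (HasCompactSupport.of_compactSpace _)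
    exact continuous_const.mul ((Complex.continuous_ofReal.comp (continuous_fejerKernel p)).mul
      (fourier (ν j)).continuous)

/-- Absolute values go inside the integral, so that a supremum over other indices can be taken
there; the factor `2π ≥ 1` on the left is discarded. -/
lemma enorm_trigSum_fejerWeight_le (s : Finset (Fin N → ℤ)) (b : (Fin N → ℤ) → ℂ) (p : ℕ)
    (j : Fin N) (x : Torus N) :
    ‖∑ ν ∈ s, b ν * fejerWeight p (ν j) * torusExp ν x‖ₑ ≤ ENNReal.ofReal (1 + Real.pi ^ 2) *
      ∫⁻ t : Circ, ENNReal.ofReal (fejerMajorant p t) *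
        ‖∑ ν ∈ s, b ν * torusExp ν (x + coordHom j t)‖ₑ := by
  have hπ := Real.pi_gt_three
  rw [← lintegral_const_mul' _ _ (by finiteness)]
  calc ‖∑ ν ∈ s, b ν * fejerWeight p (ν j) * torusExp ν x‖ₑ
      ≤ ‖2 * (Real.pi : ℂ) * ∑ ν ∈ s, b ν * fejerWeight p (ν j) * torusExp ν x‖ₑ := by
        rw [enorm_mul]
        refine le_mul_of_one_le_left zero_le ?_
        have : (2 * (Real.pi : ℂ)) = ((2 * Real.pi : ℝ) : ℂ) := by push_cast; rfl
        rw [this, ← ofReal_norm, Complex.norm_real, Real.norm_eq_abs,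
          abs_of_pos Real.two_pi_pos]
        exact ENNReal.one_le_ofReal.2 (by linarith)
    _ ≤ _ := by
        rw [trigSum_fejerWeight]
        refine (enorm_integral_le_lintegral_enorm _).trans (lintegral_mono fun t => ?_)
        rw [enorm_mul, ← mul_assoc]
        refine mul_le_mul_left ?_ _
        rw [← ofReal_norm, Complex.norm_real, Real.norm_eq_abs,
          abs_of_nonneg (fejerKernel_nonneg p t), ← ENNReal.ofReal_mul (by positivity)]
        exact ENNReal.ofReal_le_ofReal (fejerKernel_le p t)

/-- Fejér averages in one more coordinate preserve maximal bounds. -/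
theorem HasMaximalBound.mul_fejerWeight [Countable ι] {w : ι → (Fin N → ℤ) → ℝ}
    (hw : HasMaximalBound w) (j : Fin N) (k : ι → ℕ) :
    HasMaximalBound fun i ν => w i ν * fejerWeight (k i) (ν j) := by
  obtain ⟨B, hB⟩ := hw
  refine ⟨(1 + Real.pi ^ 2).toNNReal ^ 2 * ((2 * (4 * Real.pi.toNNReal)) ^ 2 * B), fun s c => ?_⟩
  -- Taking the old supremum inside the Fejér integral decouples it from the new order `k i`: the
  -- one-coordinate maximal theorem is applied to the single function `H`.
  set H : Torus N → ℝ≥0∞ := fun x => ⨆ i, ‖∑ ν ∈ s, c ν * w i ν * torusExp ν x‖ₑ with hH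
  have hHm : Measurable H := Measurable.iSup fun i => measurable_enorm_trigSum s _
  have hpt : ∀ x : Torus N,
      (⨆ i, ‖∑ ν ∈ s, c ν * ((w i ν * fejerWeight (k i) (ν j) : ℝ) : ℂ) * torusExp ν x‖ₑ ^ 2) ≤
      ENNReal.ofReal (1 + Real.pi ^ 2) ^ 2 * ⨆ p, (∫⁻ t : Circ,
        ENNReal.ofReal (fejerMajorant p t) * H (x + coordHom j t)) ^ 2 := by
    intro x
    refine iSup_le fun i => ?_
    refine le_trans ?_ (mul_le_mul_right (le_iSup _ (k i)) _)
    rw [← mul_pow]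
    refine pow_le_pow_left₀ zero_le ?_ 2
    have e : ∀ ν, c ν * ((w i ν * fejerWeight (k i) (ν j) : ℝ) : ℂ) * torusExp ν x
        = (c ν * w i ν) * fejerWeight (k i) (ν j) * torusExp ν x := fun ν => by push_cast; ring
    simp only [e]
    refine (enorm_trigSum_fejerWeight_le s _ (k i) j x).trans ?_
    refine mul_le_mul_right (lintegral_mono fun t => mul_le_mul_right ?_ _) _
    exact le_iSup (fun i => ‖∑ ν ∈ s, c ν * w i ν * torusExp ν (x + coordHom j t)‖ₑ) i
  have hH2 : ∫⁻ x, H x ^ 2 ≤ B * ∑ ν ∈ s, ‖c ν‖ₑ ^ 2 := by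
    simp only [hH, ENNReal.iSup_pow_of_ne_zero two_ne_zero]
    exact hB s c
  calc _ ≤ ENNReal.ofReal (1 + Real.pi ^ 2) ^ 2 * ∫⁻ x, ⨆ p, (∫⁻ t : Circ,
        ENNReal.ofReal (fejerMajorant p t) * H (x + coordHom j t)) ^ 2 := by
        rw [← lintegral_const_mul' _ _ (by finiteness)]
        exact lintegral_mono hpt
    _ ≤ ENNReal.ofReal (1 + Real.pi ^ 2) ^ 2 * ((2 * (4 * Real.pi.toNNReal : ℝ≥0)) ^ 2 *
          (B * ∑ ν ∈ s, ‖c ν‖ₑ ^ 2)) :=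
        mul_le_mul_right ((lintegral_iSup_fejerMajorant_sq_le j hHm).trans
          (mul_le_mul_right hH2 _)) _
    _ = _ := by
        rw [ENNReal.ofReal]
        push_cast
        ring

/-! ### Lacunary partial sums -/

/-- The weight `1_{|l| ≤ n}` minus the Fejér weight of order `n`. -/
noncomputable def lacunaryDefect (n : ℕ) (l : ℤ) : ℝ :=
  (if |l| ≤ (n : ℤ) then 1 else 0) - fejerWeight n l

/-- For `|l| ≤ n` the defect is `|l| / (n + 1)`; for larger `|l|` both weights vanish. -/
lemma lacunaryDefect_sq_le {n : ℕ} (hn : 0 < n) (l : ℤ) :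
    lacunaryDefect n l ^ 2 ≤ if |l| ≤ (n : ℤ) then (|(l : ℝ)| / n) ^ 2 else 0 := by
  unfold lacunaryDefect
  split_ifs with h
  · rw [fejerWeight_of_le h, sub_sub_cancel]
    have : (0 : ℝ) < n := by exact_mod_cast hn
    gcongr
    linarith
  · rw [fejerWeight_eq_zero (by omega)]; simp

lemma IsLacunary.pos {a : ℕ → ℕ} (ha : IsLacunary a) (n : ℕ) : 0 < a n := by
  obtain ⟨h0, q, hq, h⟩ := ha
  rcases Nat.eq_zero_or_pos (a n) with h1 | h1
  · cases n with
    | zero => omega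
    | succ n =>
      have := h n
      rw [h1] at this
      simp at this
      linarith
  · exact h1

/-- Terms with `a n < |l|` vanish. The remaining ones are at most `(|l| / a n)²`, which starts at a
value `≤ 1` and decays geometrically with ratio `r = q⁻²`. -/
lemma IsLacunary.exists_sum_defect_le {a : ℕ → ℕ} (ha : IsLacunary a) :
    ∃ C : ℝ, 0 ≤ C ∧ ∀ (l : ℤ) (L : ℕ),
      ∑ n ∈ Finset.range L, lacunaryDefect (a n) l ^ 2 ≤ C := by
  have hpos := ha.pos
  obtain ⟨h0, q, hq, h⟩ := ha
  set r : ℝ := (q ^ 2)⁻¹ with hr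
  have hr1 : r < 1 := inv_lt_one_of_one_lt₀ (by nlinarith)
  have hr0 : 0 < r := by positivity
  have hr1' : 0 < 1 - r := by linarith
  refine ⟨1 / (1 - r), by positivity, fun l L => ?_⟩
  have hstep : ∀ n, (|(l : ℝ)| / a (n + 1)) ^ 2 ≤ r * (|(l : ℝ)| / a n) ^ 2 := by
    intro n
    have h1 : (0 : ℝ) < a n := by exact_mod_cast hpos n
    have h2 : (0 : ℝ) < a (n + 1) := by exact_mod_cast hpos (n + 1)
    have h3 := h n
    rw [le_div_iff₀ h1] at h3
    have h4 : |(l : ℝ)| / a (n + 1) ≤ q⁻¹ * (|(l : ℝ)| / a n) := by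
      rw [← div_eq_inv_mul, div_div]
      exact div_le_div_of_nonneg_left (abs_nonneg _) (by positivity) (by linarith)
    calc (|(l : ℝ)| / a (n + 1)) ^ 2 ≤ (q⁻¹ * (|(l : ℝ)| / a n)) ^ 2 := by gcongr
      _ = _ := by rw [mul_pow, hr, inv_pow]
  have hone : ∀ n, |l| ≤ (a n : ℤ) → (|(l : ℝ)| / a n) ^ 2 ≤ 1 := by
    intro n hn
    have h1 : (0 : ℝ) < a n := by exact_mod_cast hpos n
    have h2 : |(l : ℝ)| ≤ a n := by exact_mod_cast hn
    have h3 : |(l : ℝ)| / a n ≤ 1 := by rwa [div_le_one h1]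
    exact pow_le_one₀ (by positivity) h3
  -- Induction invariant: either no term has contributed yet, or the partial sum together with the
  -- full geometric tail from `L` on stays below `1 / (1 - r)`.
  have key : ∀ L, (|l| ≤ (a L : ℤ) ∧ ∑ n ∈ Finset.range L, lacunaryDefect (a n) l ^ 2
      + (|(l : ℝ)| / a L) ^ 2 / (1 - r) ≤ 1 / (1 - r)) ∨
      ((a L : ℤ) < |l| ∧ ∑ n ∈ Finset.range L, lacunaryDefect (a n) l ^ 2 ≤ 0) := by
    intro L
    induction L with
    | zero =>
      rcases le_or_gt |l| (a 0 : ℤ) with hl | hl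
      · left
        refine ⟨hl, ?_⟩
        rw [Finset.range_zero, Finset.sum_empty, zero_add]
        exact div_le_div_of_nonneg_right (hone 0 hl) hr1'.le
      · right
        exact ⟨hl, by simp⟩
    | succ L ih =>
      rw [Finset.sum_range_succ]
      have hd := lacunaryDefect_sq_le (hpos L) l
      rcases ih with ⟨hl, ih⟩ | ⟨hl, ih⟩
      · left
        rw [if_pos hl] at hd
        have hmono : a L ≤ a (L + 1) := by
          have h1 : (0 : ℝ) < a L := by exact_mod_cast hpos L
          have h3 := h L
          rw [le_div_iff₀ h1] at h3
          have : (a L : ℝ) ≤ a (L + 1) := by nlinarith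
          exact_mod_cast this
        refine ⟨hl.trans (by exact_mod_cast hmono), ?_⟩
        have h5 : (|(l : ℝ)| / a (L + 1)) ^ 2 / (1 - r) ≤ r * (|(l : ℝ)| / a L) ^ 2 / (1 - r) :=
          div_le_div_of_nonneg_right (hstep L) hr1'.le
        have h6 : (|(l : ℝ)| / a L) ^ 2 + r * (|(l : ℝ)| / a L) ^ 2 / (1 - r)
            = (|(l : ℝ)| / a L) ^ 2 / (1 - r) := by
          field_simp; ring
        linarith
      · rw [if_neg (not_le.2 hl)] at hd
        rcases le_or_gt |l| (a (L + 1) : ℤ) with hl' | hl'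
        · left
          refine ⟨hl', ?_⟩
          have := div_le_div_of_nonneg_right (hone (L + 1) hl') hr1'.le
          linarith
        · right
          exact ⟨hl', by linarith⟩
  rcases key L with ⟨_, h1⟩ | ⟨_, h1⟩
  · have : 0 ≤ (|(l : ℝ)| / a L) ^ 2 / (1 - r) := by positivity
    linarith
  · exact h1.trans (by positivity)

lemma IsLacunary.exists_tsum_defect_le {a : ℕ → ℕ} (ha : IsLacunary a) :
    ∃ C : ℝ≥0, ∀ l : ℤ, ∑' n, ‖(lacunaryDefect (a n) l : ℂ)‖ₑ ^ 2 ≤ C := by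
  obtain ⟨C, hC0, hC⟩ := ha.exists_sum_defect_le
  refine ⟨C.toNNReal, fun l => ENNReal.tsum_le_of_sum_range_le fun L => ?_⟩
  have : ∀ n, ‖(lacunaryDefect (a n) l : ℂ)‖ₑ ^ 2 = ENNReal.ofReal (lacunaryDefect (a n) l ^ 2) := by
    intro n
    rw [← ofReal_norm, Complex.norm_real, ← ENNReal.ofReal_pow (norm_nonneg _),
      Real.norm_eq_abs, sq_abs]
  simp only [this]
  rw [← ENNReal.ofReal_sum_of_nonneg fun n _ => sq_nonneg _]
  exact ENNReal.ofReal_le_ofReal (hC l L)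

lemma ENNReal.add_sq_le_four_mul (a b : ℝ≥0∞) : (a + b) ^ 2 ≤ 4 * (a ^ 2 + b ^ 2) := by
  have h : a + b ≤ 2 * max a b := by
    rw [two_mul]; exact add_le_add (le_max_left _ _) (le_max_right _ _)
  calc (a + b) ^ 2 ≤ (2 * max a b) ^ 2 := pow_le_pow_left₀ zero_le h 2
    _ = 4 * max a b ^ 2 := by rw [mul_pow]; norm_num
    _ ≤ _ := by
      refine mul_le_mul_right ?_ _
      rcases max_choice a b with h | h <;> rw [h]
      · exact le_self_add
      · exact le_add_self

/-- Lacunary partial sums in one more coordinate preserve maximal bounds. -/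
theorem HasMaximalBound.mul_lacunary [Countable ι] {w : ι → (Fin N → ℤ) → ℝ}
    (hw : HasMaximalBound w) (j : Fin N) {a : ℕ → ℕ} (ha : IsLacunary a) (k : ι → ℕ) :
    HasMaximalBound fun i ν => w i ν * if |ν j| ≤ (a (k i) : ℤ) then 1 else 0 := by
  obtain ⟨B₁, hB₁⟩ := hw.mul_fejerWeight j fun i => a (k i)
  obtain ⟨B, hB⟩ := hw
  obtain ⟨C, hC⟩ := ha.exists_tsum_defect_le
  refine ⟨4 * (B₁ + B * C), fun s c => ?_⟩
  -- `Q` is the Fejér part and `P n` the maximal function of the defect part of order `a n`, with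
  -- `i` now independent of `n`. The defect is absorbed into the coefficients, and the supremum over
  -- orders is bounded by `∑ P n`.
  set P : ℕ → Torus N → ℝ≥0∞ := fun n x =>
    ⨆ i, ‖∑ ν ∈ s, c ν * lacunaryDefect (a n) (ν j) * w i ν * torusExp ν x‖ₑ ^ 2 with hP
  set Q : Torus N → ℝ≥0∞ := fun x =>
    ⨆ i, ‖∑ ν ∈ s, c ν * ((w i ν * fejerWeight (a (k i)) (ν j) : ℝ) : ℂ) * torusExp ν x‖ₑ ^ 2
    with hQ
  have hPm : ∀ n, Measurable (P n) := fun n =>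
    Measurable.iSup fun i => (measurable_enorm_trigSum s _).pow_const 2
  have hQm : Measurable Q := Measurable.iSup fun i => (measurable_enorm_trigSum s _).pow_const 2
  have hpt : ∀ x : Torus N, (⨆ i, ‖∑ ν ∈ s, c ν *
      ((w i ν * (if |ν j| ≤ (a (k i) : ℤ) then 1 else 0) : ℝ) : ℂ) * torusExp ν x‖ₑ ^ 2) ≤
      4 * (Q x + ∑' n, P n x) := by
    intro x
    refine iSup_le fun i => ?_
    have e : ∑ ν ∈ s, c ν * ((w i ν * (if |ν j| ≤ (a (k i) : ℤ) then 1 else 0) : ℝ) : ℂ) *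
          torusExp ν x
        = ∑ ν ∈ s, c ν * ((w i ν * fejerWeight (a (k i)) (ν j) : ℝ) : ℂ) * torusExp ν x
        + ∑ ν ∈ s, c ν * lacunaryDefect (a (k i)) (ν j) * w i ν * torusExp ν x := by
      rw [← Finset.sum_add_distrib]
      refine Finset.sum_congr rfl fun ν _ => ?_
      unfold lacunaryDefect
      push_cast
      ring
    rw [e]
    refine (pow_le_pow_left₀ zero_le (enorm_add_le _ _) 2).trans
      ((ENNReal.add_sq_le_four_mul _ _).trans (mul_le_mul_right (add_le_add ?_ ?_) _))
    · exact le_iSup (fun i => ‖∑ ν ∈ s, c ν * ((w i ν * fejerWeight (a (k i)) (ν j) : ℝ) : ℂ) *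
        torusExp ν x‖ₑ ^ 2) i
    · refine le_trans ?_ (ENNReal.le_tsum (k i))
      exact le_iSup (fun i' => ‖∑ ν ∈ s, c ν * lacunaryDefect (a (k i)) (ν j) * w i' ν *
        torusExp ν x‖ₑ ^ 2) i
  have hsum : ∑' n, ∫⁻ x, P n x ≤ B * C * ∑ ν ∈ s, ‖c ν‖ₑ ^ 2 := by
    calc ∑' n, ∫⁻ x, P n x
        ≤ ∑' n, B * ∑ ν ∈ s, ‖c ν * lacunaryDefect (a n) (ν j)‖ₑ ^ 2 :=
          ENNReal.tsum_le_tsum fun n => hB s fun ν => c ν * lacunaryDefect (a n) (ν j)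
      _ = B * ∑ ν ∈ s, ‖c ν‖ₑ ^ 2 * ∑' n, ‖(lacunaryDefect (a n) (ν j) : ℂ)‖ₑ ^ 2 := by
          rw [ENNReal.tsum_mul_left, Summable.tsum_finsetSum fun _ _ => ENNReal.summable]
          simp only [enorm_mul, mul_pow, ENNReal.tsum_mul_left]
      _ ≤ B * ∑ ν ∈ s, ‖c ν‖ₑ ^ 2 * C :=
          mul_le_mul_right (Finset.sum_le_sum fun ν _ => mul_le_mul_right (hC _) _) _
      _ = _ := by rw [← Finset.sum_mul]; ring
  calc _ ≤ ∫⁻ x, 4 * (Q x + ∑' n, P n x) := lintegral_mono hpt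
    _ = 4 * ((∫⁻ x, Q x) + ∑' n, ∫⁻ x, P n x) := by
        rw [lintegral_const_mul' _ _ (by norm_num), lintegral_add_left hQm,
          lintegral_tsum fun n => (hPm n).aemeasurable]
    _ ≤ 4 * (B₁ * ∑ ν ∈ s, ‖c ν‖ₑ ^ 2 + B * C * ∑ ν ∈ s, ‖c ν‖ₑ ^ 2) :=
        mul_le_mul_right (add_le_add (hB₁ s c) hsum) _
    _ = _ := by push_cast; ring

end Multipliers

/-! ### The `TT*` method for kernels with symmetric majorants -/

section TTStar

/-- A weighted arithmetic-geometric mean inequality, `a b k ≤ (a √p)(b √q)`, arranged to avoid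
roots. -/
lemma ENNReal.mul_mul_le_of_sq_le {a b k p q : ℝ≥0∞} (h : k ^ 2 ≤ p * q) :
    a * b * k ≤ a ^ 2 * p + b ^ 2 * q := by
  refine (ENNReal.pow_le_pow_left_iff two_ne_zero).1 ?_
  calc (a * b * k) ^ 2 = a ^ 2 * b ^ 2 * k ^ 2 := by ring
    _ ≤ a ^ 2 * b ^ 2 * (p * q) := mul_le_mul_right h _
    _ = (a ^ 2 * p) * (b ^ 2 * q) := by ring
    _ ≤ (a ^ 2 * p + b ^ 2 * q) * (a ^ 2 * p + b ^ 2 * q) :=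
        mul_le_mul' le_self_add le_add_self
    _ = _ := (sq _).symm

variable {X I : Type*} [MeasurableSpace X] {μ : Measure X} [IsFiniteMeasure μ]

/-- If `P` dominates the kernel of the synthesis operator of the system `E` composed with its
adjoint, then the synthesis operator is bounded on `ℓ²`. -/
theorem lintegral_enorm_sum_sq_le_of_kernel (s Q : Finset I) (hsQ : s ⊆ Q) (ρ : I → ℝ)
    (hρ : ∀ i, 0 ≤ ρ i) {η : ℝ} (hη : 0 < η) (hρη : ∀ i ∈ s, η ≤ ρ i) (E : I → X → ℂ)
    (hE : ∀ i, Measurable (E i)) (M : ℝ) (hM : ∀ i x, ‖E i x‖ ≤ M)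
    (P P' : X → X → ℝ≥0∞) (hP' : Measurable (Function.uncurry P')) (hPm : ∀ x, Measurable (P x))
    (D : ℝ≥0) (hPD : ∀ x, ∫⁻ y, P x y ∂μ ≤ D) (hPD' : ∀ y, ∫⁻ x, P' x y ∂μ ≤ D)
    (hK : ∀ x y, ‖∑ i ∈ Q, ρ i * (conj (E i x) * E i y)‖ₑ ^ 2 ≤ P x y * P' x y) (c : I → ℂ) :
    ∫⁻ x, ‖∑ i ∈ s, c i * E i x‖ₑ ^ 2 ∂μ ≤
      ENNReal.ofReal (2 * D / η) * ∑ i ∈ s, ‖c i‖ₑ ^ 2 := by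
  -- With `a i = ∫ conj (E i) G` and `J = ‖G‖²`, one has `J = ∑ conj (c i) a i`, hence `J² ≤ ∑ |c
  -- i|² · ∑ |a i|²`. The last sum is at most `η⁻¹ ∑_Q ρ i |a i|²`, the quadratic form of the kernel
  -- at `G`, which is bounded by `2 D J`.
  set G : X → ℂ := fun x => ∑ i ∈ s, c i * E i x with hG
  have hGm : Measurable G := Finset.measurable_sum _ fun i _ => (hE i).const_mul _
  have hGb : ∀ x, ‖G x‖ ≤ ∑ i ∈ s, ‖c i‖ * M := fun x => by
    refine (norm_sum_le _ _).trans (Finset.sum_le_sum fun i _ => ?_)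
    rw [norm_mul]; gcongr; exact hM i x
  set L : ℝ := ∑ i ∈ s, ‖c i‖ * M with hL
  have hEG : ∀ i, Integrable (fun x => conj (E i x) * G x) μ := fun i =>
    Integrable.of_bound ((Complex.continuous_conj.measurable.comp (hE i)).mul
      hGm).aestronglyMeasurable (M * L) (.of_forall fun x => by
        rw [norm_mul, RCLike.norm_conj]
        exact mul_le_mul (hM i x) (hGb x) (norm_nonneg _) ((norm_nonneg _).trans (hM i x)))
  have hEG' : ∀ i, Integrable (fun x => conj (G x) * E i x) μ := fun i =>
    Integrable.of_bound ((Complex.continuous_conj.measurable.comp hGm).mul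
      (hE i)).aestronglyMeasurable (L * M) (.of_forall fun x => by
        rw [norm_mul, RCLike.norm_conj]
        exact mul_le_mul (hGb x) (hM i x) (norm_nonneg _) ((norm_nonneg _).trans (hGb x)))
  have hG2 : Integrable (fun x => ‖G x‖ ^ 2) μ :=
    Integrable.of_bound (hGm.norm.pow_const 2).aestronglyMeasurable (L ^ 2)
      (.of_forall fun x => by
        rw [norm_pow, norm_norm]; exact pow_le_pow_left₀ (norm_nonneg _) (hGb x) 2)
  set a : I → ℂ := fun i => ∫ x, conj (E i x) * G x ∂μ with ha
  set J : ℝ := ∫ x, ‖G x‖ ^ 2 ∂μ with hJ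
  have hJ0 : 0 ≤ J := integral_nonneg fun x => sq_nonneg _
  have hJl : ∫⁻ x, ‖G x‖ₑ ^ 2 ∂μ = ENNReal.ofReal J := by
    rw [hJ, ofReal_integral_eq_lintegral_ofReal hG2 (.of_forall fun x => sq_nonneg _)]
    refine lintegral_congr fun x => ?_
    rw [← ofReal_norm, ENNReal.ofReal_pow (norm_nonneg _)]
  have hJa : (J : ℂ) = ∑ i ∈ s, conj (c i) * a i := by
    have h1 : (J : ℂ) = ∫ x, ((‖G x‖ ^ 2 : ℝ) : ℂ) ∂μ := integral_complex_ofReal.symm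
    have h2 : ∀ x, ((‖G x‖ ^ 2 : ℝ) : ℂ) = ∑ i ∈ s, conj (c i) * (conj (E i x) * G x) := by
      intro x
      push_cast
      rw [← Complex.conj_mul', hG]
      simp only [map_sum, map_mul, Finset.sum_mul, mul_assoc]
    rw [h1]
    simp only [h2]
    rw [integral_finsetSum _ fun i _ => (hEG i).const_mul _]
    simp only [integral_const_mul, ha]
  have hJ2 : J ^ 2 ≤ (∑ i ∈ s, ‖c i‖ ^ 2) * ∑ i ∈ s, ‖a i‖ ^ 2 := by
    have h1 : J ≤ ∑ i ∈ s, ‖c i‖ * ‖a i‖ := by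
      have : J = ‖(J : ℂ)‖ := by rw [Complex.norm_real, Real.norm_of_nonneg hJ0]
      rw [this, hJa]
      refine (norm_sum_le _ _).trans (le_of_eq ?_)
      simp only [norm_mul, RCLike.norm_conj]
    exact (pow_le_pow_left₀ hJ0 h1 2).trans (Finset.sum_mul_sq_le_sq_mul_sq _ _ _)
  have hsQ2 : η * ∑ i ∈ s, ‖a i‖ ^ 2 ≤ ∑ i ∈ Q, ρ i * ‖a i‖ ^ 2 := by
    rw [Finset.mul_sum]
    refine (Finset.sum_le_sum fun i hi => mul_le_mul_of_nonneg_right (hρη i hi)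
      (sq_nonneg _)).trans ?_
    exact Finset.sum_le_sum_of_subset_of_nonneg hsQ fun i _ _ => mul_nonneg (hρ i) (sq_nonneg _)
  have hdouble : ((∑ i ∈ Q, ρ i * ‖a i‖ ^ 2 : ℝ) : ℂ)
      = ∫ x, G x * ∫ y, conj (G y) * ∑ i ∈ Q, ρ i * (conj (E i x) * E i y) ∂μ ∂μ := by
    have hconj : ∀ i, conj (a i) = ∫ y, conj (G y) * E i y ∂μ := fun i => by
      rw [ha, ← integral_conj]
      refine integral_congr_ae (.of_forall fun y => ?_)
      simp [mul_comm]
    have h1 : ∀ x, ∫ y, conj (G y) * ∑ i ∈ Q, ρ i * (conj (E i x) * E i y) ∂μ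
        = ∑ i ∈ Q, ρ i * conj (E i x) * conj (a i) := by
      intro x
      have : ∀ y, conj (G y) * ∑ i ∈ Q, ρ i * (conj (E i x) * E i y)
          = ∑ i ∈ Q, (ρ i * conj (E i x)) * (conj (G y) * E i y) := fun y => by
        rw [Finset.mul_sum]
        exact Finset.sum_congr rfl fun i _ => by ring
      simp only [this]
      rw [integral_finsetSum _ fun i _ => (hEG' i).const_mul _]
      simp only [integral_const_mul, hconj]
    have h2 : ∀ x, G x * ∑ i ∈ Q, ρ i * conj (E i x) * conj (a i)
        = ∑ i ∈ Q, (ρ i * conj (a i)) * (conj (E i x) * G x) := fun x => by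
      rw [Finset.mul_sum]
      exact Finset.sum_congr rfl fun i _ => by ring
    simp only [h1, h2]
    rw [integral_finsetSum _ fun i _ => (hEG i).const_mul _]
    simp only [integral_const_mul]
    push_cast
    refine Finset.sum_congr rfl fun i _ => ?_
    rw [← Complex.conj_mul', ha]
    ring
  -- Schur test: `|G x|²` is paired with `P` and integrated in `y` first, `|G y|²` with `P'` and
  -- integrated in `x` first; each half gives `D J`.
  have hbound : ENNReal.ofReal (∑ i ∈ Q, ρ i * ‖a i‖ ^ 2) ≤ ENNReal.ofReal (2 * D * J) := by
    have hge : 0 ≤ ∑ i ∈ Q, ρ i * ‖a i‖ ^ 2 :=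
      Finset.sum_nonneg fun i _ => mul_nonneg (hρ i) (sq_nonneg _)
    have h0 : ENNReal.ofReal (∑ i ∈ Q, ρ i * ‖a i‖ ^ 2)
        = ‖((∑ i ∈ Q, ρ i * ‖a i‖ ^ 2 : ℝ) : ℂ)‖ₑ := by
      rw [← ofReal_norm, Complex.norm_real, Real.norm_of_nonneg hge]
    have hGP : ∀ x, Measurable fun y => ‖G x‖ₑ ^ 2 * P x y := fun x => (hPm x).const_mul _
    have hm2 : Measurable (Function.uncurry fun x y => ‖G y‖ₑ ^ 2 * P' x y) :=
      ((hGm.comp measurable_snd).enorm.pow_const 2).mul hP'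
    calc ENNReal.ofReal (∑ i ∈ Q, ρ i * ‖a i‖ ^ 2)
        ≤ ∫⁻ x, ∫⁻ y, ‖G x‖ₑ ^ 2 * P x y + ‖G y‖ₑ ^ 2 * P' x y ∂μ ∂μ := by
          rw [h0, hdouble]
          refine (enorm_integral_le_lintegral_enorm _).trans (lintegral_mono fun x => ?_)
          rw [enorm_mul]
          refine (mul_le_mul_right (enorm_integral_le_lintegral_enorm _) _).trans ?_
          rw [← lintegral_const_mul' _ _ (by finiteness)]
          refine lintegral_mono fun y => ?_
          rw [enorm_mul, ← mul_assoc]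
          have : ‖conj (G y)‖ₑ = ‖G y‖ₑ := by
            rw [← ofReal_norm, RCLike.norm_conj, ofReal_norm]
          rw [this]
          exact ENNReal.mul_mul_le_of_sq_le (hK x y)
      _ = (∫⁻ x, ‖G x‖ₑ ^ 2 * ∫⁻ y, P x y ∂μ ∂μ) + ∫⁻ y, ‖G y‖ₑ ^ 2 * ∫⁻ x, P' x y ∂μ ∂μ := by
          have i1 : ∀ x, ∫⁻ y, ‖G x‖ₑ ^ 2 * P x y + ‖G y‖ₑ ^ 2 * P' x y ∂μ
              = ‖G x‖ₑ ^ 2 * ∫⁻ y, P x y ∂μ + ∫⁻ y, ‖G y‖ₑ ^ 2 * P' x y ∂μ := fun x => by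
            rw [lintegral_add_left (hGP x), lintegral_const_mul' _ _ (by finiteness)]
          have i2 : ∀ y, ∫⁻ x, ‖G y‖ₑ ^ 2 * P' x y ∂μ = ‖G y‖ₑ ^ 2 * ∫⁻ x, P' x y ∂μ := fun y =>
            lintegral_const_mul' _ _ (by finiteness)
          have hm3 : Measurable fun x => ∫⁻ y, ‖G y‖ₑ ^ 2 * P' x y ∂μ := hm2.lintegral_prod_right'
          simp only [i1]
          rw [lintegral_add_right _ hm3, lintegral_lintegral_swap hm2.aemeasurable]
          simp only [i2]
      _ ≤ (∫⁻ x, ‖G x‖ₑ ^ 2 * D ∂μ) + ∫⁻ y, ‖G y‖ₑ ^ 2 * D ∂μ :=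
          add_le_add (lintegral_mono fun x => mul_le_mul_right (hPD x) _)
            (lintegral_mono fun y => mul_le_mul_right (hPD' y) _)
      _ = ENNReal.ofReal (2 * D * J) := by
          rw [lintegral_mul_const' _ _ (by finiteness), hJl, ENNReal.ofReal_mul (by positivity),
            ENNReal.ofReal_mul (by positivity), ENNReal.ofReal_coe_nnreal, ENNReal.ofReal_ofNat]
          ring
  have hbound' : ∑ i ∈ Q, ρ i * ‖a i‖ ^ 2 ≤ 2 * D * J :=
    (ENNReal.ofReal_le_ofReal_iff (by positivity)).1 hbound
  have hc0 : 0 ≤ ∑ i ∈ s, ‖c i‖ ^ 2 := Finset.sum_nonneg fun i _ => sq_nonneg _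
  have hfinal : J ≤ 2 * D / η * ∑ i ∈ s, ‖c i‖ ^ 2 := by
    rcases hJ0.eq_or_lt with h | h
    · rw [← h]; positivity
    · have h1 : ∑ i ∈ s, ‖a i‖ ^ 2 ≤ 2 * D * J / η := by
        rw [le_div_iff₀ hη]; linarith
      have h2 := hJ2.trans (mul_le_mul_of_nonneg_left h1 hc0)
      have h3 : (∑ i ∈ s, ‖c i‖ ^ 2) * (2 * D * J / η)
          = (2 * D / η * ∑ i ∈ s, ‖c i‖ ^ 2) * J := by ring
      rw [h3, sq] at h2
      exact le_of_mul_le_mul_right h2 h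
  rw [hJl]
  refine (ENNReal.ofReal_le_ofReal hfinal).trans (le_of_eq ?_)
  rw [ENNReal.ofReal_mul (by positivity), ENNReal.ofReal_sum_of_nonneg fun i _ => sq_nonneg _]
  congr 1
  refine Finset.sum_congr rfl fun i _ => ?_
  rw [← ofReal_norm, ENNReal.ofReal_pow (norm_nonneg _)]

end TTStar

/-! ### Free partial sums with the logarithmic weight -/

section Free

/-- The weight `1_{|k| ≤ m} / √(log (m + 2))`. -/
noncomputable def freeWeight (m : ℕ) (k : ℤ) : ℝ :=
  if |k| ≤ (m : ℤ) then (√(Real.log (m + 2)))⁻¹ else 0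

lemma log_add_two_pos (m : ℕ) : 0 < Real.log ((m : ℝ) + 2) :=
  Real.log_pos (by have : (0 : ℝ) ≤ m := by positivity
                   linarith)

lemma abs_freeWeight_le (m : ℕ) (k : ℤ) : |freeWeight m k| ≤ (√(Real.log 2))⁻¹ := by
  have h2 : 0 < Real.log 2 := Real.log_pos (by norm_num)
  unfold freeWeight
  split_ifs with h
  · rw [abs_of_nonneg (by positivity)]
    have hm : (0 : ℝ) ≤ m := by positivity
    gcongr
    linarith
  · rw [abs_zero]; positivity

/-- The product of two cutoffs is the cutoff at `min m m'`, and its kernel lies below both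
majorants; squaring separates a factor in `m` from a factor in `m'`. -/
lemma norm_sum_freeWeight_sq_le {m m' R : ℕ} (hm : m ≤ R) (t : Circ) :
    ‖∑ k ∈ Finset.Icc (-(R : ℤ)) R, ((freeWeight m k * freeWeight m' k : ℝ) : ℂ) * fourier k t‖ ^ 2
      ≤ (dirichletMajorant m t / Real.log (m + 2)) *
        (dirichletMajorant m' t / Real.log (m' + 2)) := by
  have hL := log_add_two_pos m
  have hL' := log_add_two_pos m'
  have h : ∀ k : ℤ, ((freeWeight m k * freeWeight m' k : ℝ) : ℂ) * fourier k t
      = (((√(Real.log (m + 2)))⁻¹ * (√(Real.log (m' + 2)))⁻¹ : ℝ) : ℂ) *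
        (((if |k| ≤ ((min m m' : ℕ) : ℤ) then (1 : ℝ) else 0 : ℝ) : ℂ) * fourier k t) := by
    intro k
    rw [← mul_assoc, ← Complex.ofReal_mul]
    congr 2
    simp only [freeWeight, Nat.cast_min, le_min_iff]
    by_cases h1 : |k| ≤ (m : ℤ) <;> by_cases h2 : |k| ≤ (m' : ℤ) <;> simp [h1, h2]
  simp only [h]
  rw [← Finset.mul_sum, ← dirichletKernel_eq_sum ((min_le_left _ _).trans hm), norm_mul, mul_pow,
    Complex.norm_real, Real.norm_eq_abs, sq_abs, mul_pow, inv_pow, inv_pow, Real.sq_sqrt hL.le,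
    Real.sq_sqrt hL'.le]
  have hD := norm_dirichletKernel_le (min m m') t
  have h1 := hD.trans (dirichletMajorant_mono (min_le_left m m') t)
  have h2 := hD.trans (dirichletMajorant_mono (min_le_right m m') t)
  have h3 : ‖dirichletKernel (min m m') t‖ ^ 2 ≤ dirichletMajorant m t * dirichletMajorant m' t := by
    rw [sq]
    exact mul_le_mul h1 h2 (norm_nonneg _) (dirichletMajorant_nonneg _ _)
  calc _ ≤ (Real.log (m + 2))⁻¹ * (Real.log (m' + 2))⁻¹ *
        (dirichletMajorant m t * dirichletMajorant m' t) := by gcongr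
    _ = _ := by ring

variable {N : ℕ}

/-- The majorant, in the `j`-th coordinate, of the kernel of the free partial sums in the
coordinates `F`, regularized by a Fejér kernel of order `R` in the other coordinates. -/
noncomputable def freeMajorant (F : Finset (Fin N)) (R : ℕ) (m : Fin N → ℕ) (j : Fin N) (t : Circ) :
    ℝ :=
  if j ∈ F then dirichletMajorant (m j) t / Real.log (m j + 2)
  else (1 + Real.pi ^ 2) * fejerMajorant R t

lemma freeMajorant_nonneg (F : Finset (Fin N)) (R : ℕ) (m : Fin N → ℕ) (j : Fin N) (t : Circ) :
    0 ≤ freeMajorant F R m j t := by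
  unfold freeMajorant
  split_ifs
  · exact div_nonneg (dirichletMajorant_nonneg _ _) (log_add_two_pos _).le
  · exact mul_nonneg (by positivity) (fejerMajorant_nonneg _ _)

lemma freeMajorant_neg (F : Finset (Fin N)) (R : ℕ) (m : Fin N → ℕ) (j : Fin N) (t : Circ) :
    freeMajorant F R m j (-t) = freeMajorant F R m j t := by
  simp only [freeMajorant, dirichletMajorant_neg, fejerMajorant_neg]

lemma continuous_freeMajorant (F : Finset (Fin N)) (R : ℕ) (m : Fin N → ℕ) (j : Fin N) :
    Continuous (freeMajorant F R m j) := by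
  unfold freeMajorant
  split_ifs
  · exact (continuous_dirichletMajorant _).div_const _
  · exact (continuous_fejerMajorant _).const_mul _

/-- The product of the coordinate majorants. -/
noncomputable def freeKernel (F : Finset (Fin N)) (R : ℕ) (m : Fin N → ℕ) (x : Torus N) : ℝ :=
  ∏ j, freeMajorant F R m j (x j)

lemma freeKernel_nonneg (F : Finset (Fin N)) (R : ℕ) (m : Fin N → ℕ) (x : Torus N) :
    0 ≤ freeKernel F R m x :=
  Finset.prod_nonneg fun j _ => freeMajorant_nonneg F R m j (x j)

lemma freeKernel_neg (F : Finset (Fin N)) (R : ℕ) (m : Fin N → ℕ) (x : Torus N) :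
    freeKernel F R m (-x) = freeKernel F R m x :=
  Finset.prod_congr rfl fun j _ => freeMajorant_neg F R m j (x j)

lemma continuous_freeKernel (F : Finset (Fin N)) (R : ℕ) (m : Fin N → ℕ) :
    Continuous (freeKernel F R m) :=
  continuous_finsetProd _ fun j _ => (continuous_freeMajorant F R m j).comp (continuous_apply j)

lemma measurable_freeKernel_comp (F : Finset (Fin N)) (R : ℕ) {Y : Type*} [MeasurableSpace Y]
    {k : Y → Fin N → ℕ} {z : Y → Torus N} (hk : Measurable k) (hz : Measurable z) :
    Measurable fun y => ENNReal.ofReal (freeKernel F R (k y) (z y)) :=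
  measurable_comp_selection (f := fun m x => ENNReal.ofReal (freeKernel F R m x))
    (fun m => (continuous_freeKernel F R m).measurable.ennreal_ofReal) hk hz

/-- The integral factorizes; dividing by `log (m j + 2)` cancels exactly the growth of the
integrated Dirichlet majorant, and the Fejér factors contribute at most `(1 + π²) π`. -/
lemma exists_lintegral_freeKernel_le (N : ℕ) : ∃ D : ℝ≥0, ∀ (F : Finset (Fin N)) (R : ℕ)
    (m : Fin N → ℕ), ∫⁻ x : Torus N, ENNReal.ofReal (freeKernel F R m x) ≤ D := by
  obtain ⟨C, hC0, hC⟩ := integral_dirichletMajorant_le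
  set A : ℝ := max C ((1 + Real.pi ^ 2) * Real.pi) with hA
  have hπ := Real.pi_pos
  have hA0 : 0 ≤ A := hC0.trans (le_max_left _ _)
  refine ⟨(A ^ N).toNNReal, fun F R m => ?_⟩
  rw [← ofReal_integral_eq_lintegral_ofReal]
  · refine ENNReal.ofReal_le_ofReal ?_
    unfold freeKernel
    rw [integral_fintype_prod_volume_eq_prod (fun j => freeMajorant F R m j)]
    have : ∀ j ∈ Finset.univ, ∫ t : Circ, freeMajorant F R m j t ≤ A := by
      intro j _
      unfold freeMajorant
      split_ifs
      · rw [integral_div, div_le_iff₀ (log_add_two_pos _)]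
        exact (hC _).trans (mul_le_mul_of_nonneg_right (le_max_left _ _) (log_add_two_pos _).le)
      · rw [integral_const_mul]
        exact (mul_le_mul_of_nonneg_left (integral_fejerMajorant_le R) (by positivity)).trans
          (le_max_right _ _)
    refine (Finset.prod_le_prod (fun j _ => integral_nonneg (freeMajorant_nonneg F R m j))
      this).trans (le_of_eq ?_)
    simp
  · exact (continuous_freeKernel F R m).integrable_of_hasCompactSupport
      (HasCompactSupport.of_compactSpace _)
  · exact .of_forall (freeKernel_nonneg F R m)

lemma conj_torusExp_mul (ν : Fin N → ℤ) (x y : Torus N) :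
    conj (torusExp ν x) * torusExp ν y = ∏ j, fourier (ν j) (y j - x j) := by
  unfold torusExp
  rw [map_prod, ← Finset.prod_mul_distrib]
  refine Finset.prod_congr rfl fun j _ => ?_
  rw [← fourier_neg, sub_eq_add_neg]
  simp only [fourier_apply, smul_add, AddCircle.toCircle_add, Circle.coe_mul, smul_neg, neg_smul]
  ring

/-- The frequencies `ν` with `|ν_j| ≤ R` for all `j`. -/
noncomputable def freqBox (N R : ℕ) : Finset (Fin N → ℤ) :=
  Fintype.piFinset fun _ => Finset.Icc (-(R : ℤ)) R

lemma mem_freqBox {R : ℕ} {ν : Fin N → ℤ} : ν ∈ freqBox N R ↔ ∀ j, |ν j| ≤ (R : ℤ) := by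
  simp only [freqBox, Fintype.mem_piFinset, Finset.mem_Icc, abs_le]

lemma exists_subset_freqBox (s : Finset (Fin N → ℤ)) : ∃ R, s ⊆ freqBox N R := by
  refine ⟨s.sup fun ν => Finset.univ.sup fun j => (ν j).natAbs, fun ν hν => mem_freqBox.2 fun j => ?_⟩
  have h1 : (ν j).natAbs ≤ Finset.univ.sup fun j => (ν j).natAbs :=
    Finset.le_sup (f := fun j => (ν j).natAbs) (Finset.mem_univ j)
  have h2 := Finset.le_sup (f := fun ν : Fin N → ℤ => Finset.univ.sup fun j => (ν j).natAbs) hν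
  have := h1.trans h2
  rw [Int.abs_eq_natAbs]
  exact_mod_cast this

/-- The sum over the box is a product of one-dimensional sums. Without the Fejér weights, the
coordinates outside `F` would give Dirichlet kernels of order `R`, whose `L¹` norms are unbounded in
`R`. -/
lemma norm_free_kernel_sq_le (F : Finset (Fin N)) {R : ℕ} {m m' : Fin N → ℕ} (hm : ∀ j, m j ≤ R)
    (x y : Torus N) :
    ‖∑ ν ∈ freqBox N R, ((∏ j ∈ Fᶜ, fejerWeight R (ν j) : ℝ) : ℂ) *
      (conj (((∏ j ∈ F, freeWeight (m j) (ν j) : ℝ) : ℂ) * torusExp ν x) *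
        (((∏ j ∈ F, freeWeight (m' j) (ν j) : ℝ) : ℂ) * torusExp ν y))‖ ^ 2
      ≤ freeKernel F R m (y - x) * freeKernel F R m' (y - x) := by
  have h : ∀ ν : Fin N → ℤ, ((∏ j ∈ Fᶜ, fejerWeight R (ν j) : ℝ) : ℂ) *
      (conj (((∏ j ∈ F, freeWeight (m j) (ν j) : ℝ) : ℂ) * torusExp ν x) *
        (((∏ j ∈ F, freeWeight (m' j) (ν j) : ℝ) : ℂ) * torusExp ν y))
      = ∏ j, ((if j ∈ F then freeWeight (m j) (ν j) * freeWeight (m' j) (ν j)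
          else fejerWeight R (ν j) : ℝ) : ℂ) * fourier (ν j) (y j - x j) := by
    intro ν
    rw [Finset.prod_mul_distrib, ← conj_torusExp_mul, ← Complex.ofReal_prod,
      ← Finset.prod_mul_prod_compl F]
    have h1 : ∏ j ∈ F, (if j ∈ F then freeWeight (m j) (ν j) * freeWeight (m' j) (ν j)
        else fejerWeight R (ν j)) = ∏ j ∈ F, freeWeight (m j) (ν j) * freeWeight (m' j) (ν j) :=
      Finset.prod_congr rfl fun j hj => if_pos hj
    have h2 : ∏ j ∈ Fᶜ, (if j ∈ F then freeWeight (m j) (ν j) * freeWeight (m' j) (ν j)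
        else fejerWeight R (ν j)) = ∏ j ∈ Fᶜ, fejerWeight R (ν j) :=
      Finset.prod_congr rfl fun j hj => if_neg (Finset.mem_compl.1 hj)
    rw [h1, h2, Finset.prod_mul_distrib, map_mul, Complex.conj_ofReal]
    push_cast
    ring
  simp only [h]
  rw [freqBox, ← Finset.prod_univ_sum (fun _ : Fin N => Finset.Icc (-(R : ℤ)) R) (fun j k =>
    ((if j ∈ F then freeWeight (m j) k * freeWeight (m' j) k
          else fejerWeight R k : ℝ) : ℂ) * fourier k (y j - x j)), norm_prod, ← Finset.prod_pow,
    freeKernel, freeKernel, ← Finset.prod_mul_distrib]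
  refine Finset.prod_le_prod (fun j _ => sq_nonneg _) fun j _ => ?_
  simp only [freeMajorant, Pi.sub_apply]
  split_ifs
  · exact norm_sum_freeWeight_sq_le (hm j) _
  · rw [sum_fejerWeight_mul_fourier le_rfl, Complex.norm_real,
      Real.norm_of_nonneg (fejerKernel_nonneg _ _), sq]
    exact mul_le_mul (fejerKernel_le _ _) (fejerKernel_le _ _) (fejerKernel_nonneg _ _)
      (mul_nonneg (by positivity) (fejerMajorant_nonneg _ _))

lemma half_le_fejerWeight {R : ℕ} {k : ℤ} (h : 2 * |k| ≤ R) : 1 / 2 ≤ fejerWeight R k := by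
  rw [fejerWeight_of_le (by have := abs_nonneg k; omega)]
  have h' : 2 * |(k : ℝ)| ≤ R := by exact_mod_cast h
  have : |(k : ℝ)| / (R + 1) ≤ 1 / 2 := by
    rw [div_le_div_iff₀ (by positivity) (by norm_num)]; linarith
  linarith

/-- Kolmogorov–Seliverstov–Plessner in several coordinates: the maximal function of the partial sums
divided by the square roots of the logarithms of their orders is bounded on `L²`. -/
theorem hasMaximalBound_free (F : Finset (Fin N)) :
    HasMaximalBound fun (m : Fin N → ℕ) ν => ∏ j ∈ F, freeWeight (m j) (ν j) := by
  obtain ⟨D, hD⟩ := exists_lintegral_freeKernel_le N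
  set η : ℝ := ∏ j ∈ Fᶜ, (1 / 2 : ℝ) with hη
  have hη0 : 0 < η := Finset.prod_pos fun _ _ => by norm_num
  refine ⟨(2 * D / η).toNNReal, fun s c => ?_⟩
  refine lintegral_iSup_le_of_selection volume _
    (fun m => (measurable_enorm_trigSum s _).pow_const 2) _ fun S κ hκ hκS => ?_
  obtain ⟨R₀, hR₀⟩ := exists_subset_freqBox s
  -- `R ≥ 2 R₀` keeps the Fejér weights at least `1/2` on `s`, whence `η`; the second summand
  -- dominates all orders selected by `κ`.
  set R : ℕ := 2 * R₀ + S.sup fun m => Finset.univ.sup m with hR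
  have hκR : ∀ x j, κ x j ≤ R := fun x j => by
    have h1 : κ x j ≤ Finset.univ.sup (κ x) := Finset.le_sup (Finset.mem_univ j)
    have h2 := Finset.le_sup (f := fun m : Fin N → ℕ => Finset.univ.sup m) (hκS x)
    have := h1.trans h2
    omega
  have hcont : ∀ (m : Fin N → ℕ) (ν : Fin N → ℤ), Measurable fun x : Torus N =>
      ((∏ j ∈ F, freeWeight (m j) (ν j) : ℝ) : ℂ) * torusExp ν x := fun m ν =>
    (continuous_torusExp ν).measurable.const_mul _
  have key := lintegral_enorm_sum_sq_le_of_kernel (μ := (volume : Measure (Torus N))) s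
    (freqBox N R) ?_ (fun ν => ∏ j ∈ Fᶜ, fejerWeight R (ν j))
    (fun ν => Finset.prod_nonneg fun j _ => fejerWeight_nonneg _ _) hη0 ?_
    (fun ν x => ((∏ j ∈ F, freeWeight (κ x j) (ν j) : ℝ) : ℂ) * torusExp ν x) ?_
    (∏ j ∈ F, (√(Real.log 2))⁻¹) ?_
    (fun x y => ENNReal.ofReal (freeKernel F R (κ x) (y - x)))
    (fun x y => ENNReal.ofReal (freeKernel F R (κ y) (y - x))) ?_ ?_ D ?_ ?_ ?_ c
  · simp only [← mul_assoc] at key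
    exact key
  · intro ν hν
    refine mem_freqBox.2 fun j => ?_
    have := mem_freqBox.1 (hR₀ hν) j
    omega
  · intro ν hν
    refine Finset.prod_le_prod (fun _ _ => by norm_num) fun j _ => half_le_fejerWeight ?_
    have := mem_freqBox.1 (hR₀ hν) j
    omega
  · intro ν
    exact measurable_comp_selection (fun m => hcont m ν) hκ measurable_id
  · intro ν x
    rw [norm_mul, norm_torusExp, mul_one, Complex.norm_real, Real.norm_eq_abs, Finset.abs_prod]
    exact Finset.prod_le_prod (fun _ _ => abs_nonneg _) fun j _ => abs_freeWeight_le _ _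
  · have h1 : Measurable fun q : Torus N × Torus N => q.2 - q.1 :=
      (continuous_snd.sub continuous_fst).measurable
    have h2 : Measurable fun q : Torus N × Torus N => κ q.2 := hκ.comp measurable_snd
    exact measurable_freeKernel_comp F R h2 h1
  · intro x
    have h1 : Continuous fun y : Torus N => freeKernel F R (κ x) (y - x) :=
      (continuous_freeKernel F R (κ x)).comp (continuous_id.sub continuous_const)
    exact h1.measurable.ennreal_ofReal
  · intro x
    refine le_trans (le_of_eq ?_) (hD F R (κ x))
    exact lintegral_sub_right_eq_self (fun y => ENNReal.ofReal (freeKernel F R (κ x) y)) x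
  · intro y
    refine le_trans (le_of_eq ?_) (hD F R (κ y))
    have : ∀ x, freeKernel F R (κ y) (y - x) = freeKernel F R (κ y) (x - y) := fun x => by
      rw [← freeKernel_neg, neg_sub]
    simp only [this]
    exact lintegral_sub_right_eq_self (fun x => ENNReal.ofReal (freeKernel F R (κ y) x)) y
  · intro x y
    rw [← ofReal_norm, ← ENNReal.ofReal_pow (norm_nonneg _),
      ← ENNReal.ofReal_mul (freeKernel_nonneg _ _ _ _)]
    exact ENNReal.ofReal_le_ofReal (norm_free_kernel_sq_le F (hκR x) x y)

end Free

/-! ### Almost everywhere bounds for square integrable functions -/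

section AlmostEverywhere

variable {N : ℕ} {ι : Type*}

lemma HasMaximalBound.mul_prod_fejerWeight [Countable ι] {w : ι → (Fin N → ℤ) → ℝ}
    (hw : HasMaximalBound w) (T : Finset (Fin N)) (k : Fin N → ι → ℕ) :
    HasMaximalBound fun i ν => w i ν * ∏ j ∈ T, fejerWeight (k j i) (ν j) := by
  classical
  induction T using Finset.induction_on with
  | empty => simpa using hw
  | insert j T hj ih =>
    have := ih.mul_fejerWeight j (k j)
    simp only [Finset.prod_insert hj]
    simpa only [mul_assoc, mul_comm (∏ j ∈ T, fejerWeight (k j _) _)] using this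

lemma HasMaximalBound.mul_prod_lacunary [Countable ι] {w : ι → (Fin N → ℤ) → ℝ}
    (hw : HasMaximalBound w) (J : Finset (Fin N)) {a : Fin N → ℕ → ℕ}
    (ha : ∀ j ∈ J, IsLacunary (a j)) (k : Fin N → ι → ℕ) :
    HasMaximalBound fun i ν => w i ν *
      ∏ j ∈ J, if |ν j| ≤ (a j (k j i) : ℤ) then (1 : ℝ) else 0 := by
  classical
  induction J using Finset.induction_on with
  | empty => simpa using hw
  | insert j J hj ih =>
    have h := (ih fun l hl => ha l (Finset.mem_insert_of_mem hl)).mul_lacunary j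
      (ha j (Finset.mem_insert_self _ _)) (k j)
    have e : ∀ (i : ι) (ν : Fin N → ℤ),
        w i ν * ∏ l ∈ insert j J, (if |ν l| ≤ (a l (k l i) : ℤ) then (1 : ℝ) else 0)
        = (w i ν * ∏ l ∈ J, if |ν l| ≤ (a l (k l i) : ℤ) then (1 : ℝ) else 0) *
          if |ν j| ≤ (a j (k j i) : ℤ) then 1 else 0 := fun i ν => by
      rw [Finset.prod_insert hj]; ring
    simp only [e]
    exact h

lemma freqBox_mono {R R' : ℕ} (h : R ≤ R') : freqBox N R ⊆ freqBox N R' := fun ν hν =>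
  mem_freqBox.2 fun j => (mem_freqBox.1 hν j).trans (by exact_mod_cast h)

/-- A maximal bound gives almost everywhere finiteness for square summable coefficients. -/
theorem HasMaximalBound.ae_iSup_lt_top [Countable ι] {w : ι → (Fin N → ℤ) → ℝ}
    (hw : HasMaximalBound w) (r : ι → ℕ) (hr : ∀ i, ∀ ν ∉ freqBox N (r i), w i ν = 0)
    (c : (Fin N → ℤ) → ℂ) (hc : ∑' ν, ‖c ν‖ₑ ^ 2 ≠ ∞) :
    ∀ᵐ x : Torus N, ⨆ i, ‖∑ ν ∈ freqBox N (r i), c ν * w i ν * torusExp ν x‖ₑ ^ 2 < ∞ := by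
  obtain ⟨B, hB⟩ := hw
  -- Coefficients are truncated to boxes. Each fixed `i` sees its full sum once `R ≥ r i`, so the
  -- wanted supremum is below `liminf V R`, which Fatou's lemma controls.
  set V : ℕ → Torus N → ℝ≥0∞ := fun R x =>
    ⨆ i, ‖∑ ν ∈ freqBox N R, c ν * w i ν * torusExp ν x‖ₑ ^ 2 with hV
  have hVm : ∀ R, Measurable (V R) := fun R =>
    Measurable.iSup fun i => (measurable_enorm_trigSum _ _).pow_const 2
  have hint : ∫⁻ x, Filter.liminf (fun R => V R x) Filter.atTop ≠ ∞ := by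
    refine ne_top_of_le_ne_top (b := B * ∑' ν, ‖c ν‖ₑ ^ 2) (by finiteness) ?_
    refine (lintegral_liminf_le hVm).trans ?_
    refine (Filter.liminf_le_liminf (v := fun _ => B * ∑' ν, ‖c ν‖ₑ ^ 2)
      (.of_forall fun R => ?_)).trans (Filter.liminf_const _).le
    exact (hB _ c).trans (mul_le_mul_right (ENNReal.sum_le_tsum _) _)
  filter_upwards [ae_lt_top (Measurable.liminf hVm) hint] with x hx
  refine lt_of_le_of_lt (iSup_le fun i => ?_) hx
  refine Filter.le_liminf_of_le (by isBoundedDefault) ?_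
  filter_upwards [Filter.eventually_ge_atTop (r i)] with R hR
  have h : ∑ ν ∈ freqBox N (r i), c ν * w i ν * torusExp ν x
      = ∑ ν ∈ freqBox N R, c ν * w i ν * torusExp ν x :=
    Finset.sum_subset (freqBox_mono hR) fun ν _ hν => by rw [hr i ν hν]; simp
  rw [h]
  exact le_iSup (fun i => ‖∑ ν ∈ freqBox N R, c ν * w i ν * torusExp ν x‖ₑ ^ 2) i

lemma torusExp_neg (ν : Fin N → ℤ) (x : Torus N) : torusExp (-ν) x = conj (torusExp ν x) := by
  unfold torusExp
  rw [map_prod]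
  exact Finset.prod_congr rfl fun j _ => by rw [Pi.neg_apply, fourier_neg]

/-- Bessel's inequality, up to a constant: the Fourier coefficients of a square integrable function
are square summable. -/
lemma tsum_enorm_torusCoeff_sq_ne_top {f : Torus N → ℂ} (hf : MemLp f 2 volume) :
    ∑' ν, ‖torusCoeff f ν‖ₑ ^ 2 ≠ ∞ := by
  -- For the empty set of coordinates every multiplier is `1`, so this is merely an `L²` bound for
  -- trigonometric polynomials, used in place of orthogonality.
  obtain ⟨B, hB⟩ := hasMaximalBound_free (∅ : Finset (Fin N))
  have hf2 : ∫⁻ x, ‖f x‖ₑ ^ 2 ≠ ∞ := by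
    have h := lintegral_rpow_enorm_lt_top_of_eLpNorm_lt_top two_ne_zero ENNReal.ofNat_ne_top
      hf.eLpNorm_lt_top
    simpa using h.ne
  have hfi : Integrable f volume := hf.integrable one_le_two
  refine ne_top_of_le_ne_top (b := (∫⁻ x, ‖f x‖ₑ ^ 2) * B) (by finiteness) ?_
  rw [ENNReal.tsum_eq_iSup_sum]
  refine iSup_le fun s => ?_
  set c := torusCoeff f with hc
  set u : Torus N → ℂ := fun x => ∑ ν ∈ s, c ν * torusExp ν x with hu
  have hu2 : ∫⁻ x, ‖u x‖ₑ ^ 2 ≤ B * ∑ ν ∈ s, ‖c ν‖ₑ ^ 2 := by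
    refine le_trans (lintegral_mono fun x => ?_) (hB s c)
    refine le_trans (le_of_eq ?_) (le_iSup _ (0 : Fin N → ℕ))
    simp [hu]
  have hfe : ∀ ν, Integrable (fun x => f x * torusExp (-ν) x) volume := fun ν =>
    hfi.mul_bdd (c := 1) (continuous_torusExp (-ν)).aestronglyMeasurable
      (.of_forall fun x => (norm_torusExp _ _).le)
  have hd : ((2 * Real.pi : ℝ) : ℂ) ^ N ≠ 0 :=
    pow_ne_zero _ (by exact_mod_cast Real.two_pi_pos.ne')
  have hpair : ∫ x, f x * conj (u x)
      = (((2 * Real.pi) ^ N * ∑ ν ∈ s, ‖c ν‖ ^ 2 : ℝ) : ℂ) := by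
    have h1 : ∀ x, f x * conj (u x) = ∑ ν ∈ s, conj (c ν) * (f x * torusExp (-ν) x) := fun x => by
      rw [hu]
      simp only [map_sum, map_mul, torusExp_neg]
      rw [Finset.mul_sum]
      exact Finset.sum_congr rfl fun ν _ => by ring
    simp only [h1]
    rw [integral_finsetSum _ fun ν _ => (hfe ν).const_mul _]
    simp only [integral_const_mul]
    have h2 : ∀ ν, ∫ x, f x * torusExp (-ν) x = ((2 * Real.pi : ℝ) : ℂ) ^ N * c ν := fun ν => by
      rw [hc, torusCoeff, inv_pow, mul_inv_cancel_left₀ hd]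
    simp only [h2]
    push_cast
    rw [Finset.mul_sum]
    refine Finset.sum_congr rfl fun ν _ => ?_
    rw [← Complex.conj_mul']; ring
  have hS : ∑ ν ∈ s, ‖c ν‖ₑ ^ 2 = ENNReal.ofReal (∑ ν ∈ s, ‖c ν‖ ^ 2) := by
    rw [ENNReal.ofReal_sum_of_nonneg fun _ _ => sq_nonneg _]
    exact Finset.sum_congr rfl fun ν _ => by rw [← ofReal_norm, ENNReal.ofReal_pow (norm_nonneg _)]
  have hle : ∑ ν ∈ s, ‖c ν‖ₑ ^ 2 ≤ ∫⁻ x, ‖f x‖ₑ * ‖u x‖ₑ := by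
    have h0 : 0 ≤ ∑ ν ∈ s, ‖c ν‖ ^ 2 := Finset.sum_nonneg fun _ _ => sq_nonneg _
    have h1 : (1 : ℝ) ≤ (2 * Real.pi) ^ N := one_le_pow₀ (by linarith [Real.pi_gt_three])
    calc ∑ ν ∈ s, ‖c ν‖ₑ ^ 2 ≤ ENNReal.ofReal ((2 * Real.pi) ^ N * ∑ ν ∈ s, ‖c ν‖ ^ 2) := by
          rw [hS]
          exact ENNReal.ofReal_le_ofReal (le_mul_of_one_le_left h0 h1)
      _ = ‖∫ x, f x * conj (u x)‖ₑ := by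
          rw [hpair, ← ofReal_norm, Complex.norm_real, Real.norm_of_nonneg (by positivity)]
      _ ≤ _ := by
          refine (enorm_integral_le_lintegral_enorm _).trans (le_of_eq ?_)
          refine lintegral_congr fun x => ?_
          rw [enorm_mul, ← ofReal_norm (conj (u x)), RCLike.norm_conj, ofReal_norm]
  -- With `Σ = ∑ ‖c ν‖²`: `Σ² ≤ ‖f‖² ‖u‖² ≤ ‖f‖² B Σ`, and the finite factor `Σ` cancels.
  refine ENNReal.le_of_sq_le_mul (by rw [hS]; exact ENNReal.ofReal_ne_top) ?_
  refine (pow_le_pow_left₀ zero_le hle 2).trans ?_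
  refine (lintegral_mul_sq_le volume hf.aestronglyMeasurable.enorm
    (measurable_enorm_trigSum s c).aemeasurable).trans ?_
  rw [mul_assoc]
  exact mul_le_mul_right hu2 _

end AlmostEverywhere

/-! ### The mixed sums -/

section LacSum

variable {N : ℕ}

lemma rectPartialSum_eq (f : Torus N → ℂ) {n : Fin N → ℕ} {R : ℕ} (hn : ∀ j, n j ≤ R)
    (x : Torus N) :
    rectPartialSum f n x = ∑ ν ∈ freqBox N R,
      ((∏ j, if |ν j| ≤ (n j : ℤ) then (1 : ℝ) else 0 : ℝ) : ℂ) *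
        (torusCoeff f ν * torusExp ν x) := by
  have h : ∀ ν : Fin N → ℤ, ((∏ j, if |ν j| ≤ (n j : ℤ) then (1 : ℝ) else 0 : ℝ) : ℂ) *
        (torusCoeff f ν * torusExp ν x)
      = if ∀ j, |ν j| ≤ (n j : ℤ) then torusCoeff f ν * torusExp ν x else 0 := by
    intro ν
    rw [Finset.prod_boole]
    split_ifs with h1 h2 h2 <;> simp_all
  simp only [h]
  rw [← Finset.sum_filter, rectPartialSum]
  refine Finset.sum_congr ?_ fun _ _ => rfl
  ext ν
  simp only [Fintype.mem_piFinset, Finset.mem_Icc, ← abs_le, Finset.mem_filter, mem_freqBox]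
  refine ⟨fun h => ⟨fun j => (h j).trans (by exact_mod_cast hn j), h⟩, fun h => h.2⟩

/-- The index whose components are `lam` on `J`, `p` on `T` and `m` elsewhere. -/
def mixedIndex (J T : Finset (Fin N)) (lam m p : Fin N → ℕ) : Fin N → ℕ :=
  fun j => if j ∈ J then lam j else if j ∈ T then p j else m j

/-- The normalized multiplier of the mixed sums. -/
noncomputable def mixedWeight (J : Finset (Fin N)) (a : Fin N → ℕ → ℕ) (T : Finset (Fin N))
    (i : Fin N → ℕ) (ν : Fin N → ℤ) : ℝ :=
  (∏ j ∈ (J ∪ T)ᶜ, freeWeight (i j) (ν j)) * (∏ j ∈ T, fejerWeight (i j) (ν j)) *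
    ∏ j ∈ J, if |ν j| ≤ (a j (i j) : ℤ) then (1 : ℝ) else 0

/-- A bound for the frequencies that the mixed multiplier of index `i` lets pass. -/
def mixedRadius (a : Fin N → ℕ → ℕ) (i : Fin N → ℕ) : ℕ :=
  Finset.univ.sup fun j => max (i j) (a j (i j))

lemma le_mixedRadius (a : Fin N → ℕ → ℕ) (i : Fin N → ℕ) (j : Fin N) :
    i j ≤ mixedRadius a i ∧ a j (i j) ≤ mixedRadius a i := by
  have := Finset.le_sup (f := fun j => max (i j) (a j (i j))) (Finset.mem_univ j)
  exact max_le_iff.1 this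

lemma mixedWeight_eq_zero (J : Finset (Fin N)) (a : Fin N → ℕ → ℕ) (T : Finset (Fin N))
    (i : Fin N → ℕ) {ν : Fin N → ℤ} (hν : ν ∉ freqBox N (mixedRadius a i)) :
    mixedWeight J a T i ν = 0 := by
  rw [mem_freqBox] at hν
  push Not at hν
  obtain ⟨j, hj⟩ := hν
  obtain ⟨h1, h2⟩ := le_mixedRadius a i j
  unfold mixedWeight
  by_cases hJ : j ∈ J
  · rw [Finset.prod_eq_zero hJ, mul_zero]
    rw [if_neg (by omega)]
  by_cases hT : j ∈ T
  · rw [Finset.prod_eq_zero hT, mul_zero, zero_mul]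
    exact fejerWeight_eq_zero (by omega)
  · rw [Finset.prod_eq_zero (i := j) (by simp [hJ, hT]), zero_mul, zero_mul]
    unfold freeWeight
    rw [if_neg (by omega)]

lemma hasMaximalBound_mixedWeight (J : Finset (Fin N)) {a : Fin N → ℕ → ℕ}
    (ha : ∀ j ∈ J, IsLacunary (a j)) (T : Finset (Fin N)) :
    HasMaximalBound (mixedWeight J a T) :=
  ((hasMaximalBound_free (J ∪ T)ᶜ).mul_prod_fejerWeight T fun j i => i j).mul_prod_lacunary J ha
    fun j i => i j

lemma prod_sum_mixed {J T : Finset (Fin N)} (hTJ : Disjoint T J) (a : Fin N → ℕ → ℕ)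
    (lam m p : Fin N → ℕ) (ν : Fin N → ℤ) :
    (∏ j, ∑ r ∈ (if j ∈ T then Finset.range (p j + 1) else {m j}),
      if |ν j| ≤ ((if j ∈ J then a j (lam j) else r : ℕ) : ℤ) then (1 : ℝ) else 0)
      = ((∏ j ∈ T, ((p j : ℝ) + 1)) * ∏ l ∈ (J ∪ T)ᶜ, √(Real.log ((m l : ℝ) + 2))) *
        mixedWeight J a T (mixedIndex J T lam m p) ν := by
  rw [← Finset.prod_mul_prod_compl (J ∪ T), Finset.prod_union hTJ.symm]
  have h1 : ∏ j ∈ J, (∑ r ∈ (if j ∈ T then Finset.range (p j + 1) else {m j}),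
      if |ν j| ≤ ((if j ∈ J then a j (lam j) else r : ℕ) : ℤ) then (1 : ℝ) else 0)
      = ∏ j ∈ J, if |ν j| ≤ (a j (mixedIndex J T lam m p j) : ℤ) then (1 : ℝ) else 0 := by
    refine Finset.prod_congr rfl fun j hj => ?_
    have hjT : j ∉ T := fun h => Finset.disjoint_left.1 hTJ h hj
    simp [hj, hjT, mixedIndex]
  have h2 : ∏ j ∈ T, (∑ r ∈ (if j ∈ T then Finset.range (p j + 1) else {m j}),
      if |ν j| ≤ ((if j ∈ J then a j (lam j) else r : ℕ) : ℤ) then (1 : ℝ) else 0)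
      = ∏ j ∈ T, ((p j + 1 : ℝ) * fejerWeight (mixedIndex J T lam m p j) (ν j)) := by
    refine Finset.prod_congr rfl fun j hj => ?_
    have hjJ : j ∉ J := Finset.disjoint_left.1 hTJ hj
    simp only [hj, hjJ, mixedIndex, if_true, if_false]
    exact sum_range_ite_abs_le _ _
  have h3 : ∏ j ∈ (J ∪ T)ᶜ, (∑ r ∈ (if j ∈ T then Finset.range (p j + 1) else {m j}),
      if |ν j| ≤ ((if j ∈ J then a j (lam j) else r : ℕ) : ℤ) then (1 : ℝ) else 0)
      = ∏ j ∈ (J ∪ T)ᶜ, (√(Real.log ((m j : ℝ) + 2)) *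
        freeWeight (mixedIndex J T lam m p j) (ν j)) := by
    refine Finset.prod_congr rfl fun j hj => ?_
    rw [Finset.mem_compl, Finset.mem_union, not_or] at hj
    have hL := (Real.sqrt_pos.2 (log_add_two_pos (m j))).ne'
    simp only [hj.1, hj.2, mixedIndex, if_false, Finset.sum_singleton, freeWeight]
    split_ifs
    · rw [mul_inv_cancel₀ hL]
    · rw [mul_zero]
  rw [h1, h2, h3, Finset.prod_mul_distrib, Finset.prod_mul_distrib, mixedWeight]
  ring

/-- After interchanging the sums, each frequency carries a sum over a product set of a product over
coordinates, which factorizes. -/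
lemma lacSum_eq {J T : Finset (Fin N)} (hTJ : Disjoint T J) (a : Fin N → ℕ → ℕ)
    (f : Torus N → ℂ) (lam m p : Fin N → ℕ) (x : Torus N) :
    lacSum J a T f lam m p x =
      (((∏ j ∈ T, ((p j : ℝ) + 1)) * ∏ l ∈ (J ∪ T)ᶜ, √(Real.log ((m l : ℝ) + 2)) : ℝ) : ℂ) *
        ∑ ν ∈ freqBox N (mixedRadius a (mixedIndex J T lam m p)),
          torusCoeff f ν * mixedWeight J a T (mixedIndex J T lam m p) ν * torusExp ν x := by
  set i := mixedIndex J T lam m p with hi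
  have h1 : ∀ r ∈ Fintype.piFinset (fun j => if j ∈ T then Finset.range (p j + 1) else {m j}),
      rectPartialSum f (lacIndex J a lam r) x = ∑ ν ∈ freqBox N (mixedRadius a i),
        ((∏ j, if |ν j| ≤ ((if j ∈ J then a j (lam j) else r j : ℕ) : ℤ) then (1 : ℝ) else 0 : ℝ) :
          ℂ) * (torusCoeff f ν * torusExp ν x) := by
    intro r hr
    refine rectPartialSum_eq f (fun j => ?_) x
    obtain ⟨h2, h3⟩ := le_mixedRadius a i j
    have hrj := Fintype.mem_piFinset.1 hr j
    by_cases hJ : j ∈ J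
    · have : i j = lam j := by simp [hi, mixedIndex, hJ]
      rw [this] at h3
      simpa [lacIndex, hJ] using h3
    by_cases hT : j ∈ T
    · have : i j = p j := by simp [hi, mixedIndex, hJ, hT]
      rw [if_pos hT, Finset.mem_range] at hrj
      simp only [lacIndex, hJ, if_false]
      omega
    · have : i j = m j := by simp [hi, mixedIndex, hJ, hT]
      rw [if_neg hT, Finset.mem_singleton] at hrj
      simp only [lacIndex, hJ, if_false]
      omega
  rw [lacSum, Finset.sum_congr rfl h1, Finset.sum_comm, Finset.mul_sum]
  refine Finset.sum_congr rfl fun ν _ => ?_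
  rw [← Finset.sum_mul, ← Complex.ofReal_sum, ← Finset.prod_univ_sum
    (fun j => if j ∈ T then Finset.range (p j + 1) else {m j}) (fun j r =>
      if |ν j| ≤ ((if j ∈ J then a j (lam j) else r : ℕ) : ℤ) then (1 : ℝ) else 0),
    prod_sum_mixed hTJ, ← hi]
  push_cast
  ring

end LacSum

theorem mainTheorem4 (N : ℕ) (J : Finset (Fin N)) (hJ : 1 ≤ J.card) (hJN : J.card + 2 ≤ N)
    (a : Fin N → ℕ → ℕ) (ha : ∀ j ∈ J, IsLacunary (a j))
    (T : Finset (Fin N)) (hT : T.Nonempty) (hTJ : Disjoint T J)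
    (f : Torus N → ℂ) (hf : MemLp f 2 volume) :
    ∀ᵐ x : Torus N, ∃ C : ℝ, ∀ lam m p : Fin N → ℕ, (∀ j ∈ T, 1 ≤ p j) →
      ‖lacSum J a T f lam m p x‖ ≤
        C * ((∏ j ∈ T, (p j : ℝ)) * ∏ l ∈ (J ∪ T)ᶜ, Real.sqrt (Real.log ((m l : ℝ) + 2))) := by
  filter_upwards [(hasMaximalBound_mixedWeight J ha T).ae_iSup_lt_top (mixedRadius a)
    (fun i ν hν => mixedWeight_eq_zero J a T i hν) (torusCoeff f)
    (tsum_enorm_torusCoeff_sq_ne_top hf)] with x hx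
  set A := ⨆ i, ‖∑ ν ∈ freqBox N (mixedRadius a i),
    torusCoeff f ν * mixedWeight J a T i ν * torusExp ν x‖ₑ ^ 2 with hA
  -- The powers of `2` come from `p + 1 ≤ 2p` for `p ≥ 1`.
  refine ⟨(∏ j ∈ T, (2 : ℝ)) * √A.toReal, fun lam m p hp => ?_⟩
  rw [lacSum_eq hTJ, norm_mul, Complex.norm_real, Real.norm_of_nonneg (by positivity)]
  set i := mixedIndex J T lam m p
  have h1 : ‖∑ ν ∈ freqBox N (mixedRadius a i),
      torusCoeff f ν * mixedWeight J a T i ν * torusExp ν x‖ ≤ √A.toReal := by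
    refine Real.le_sqrt_of_sq_le ?_
    have h2 := le_iSup (fun i => ‖∑ ν ∈ freqBox N (mixedRadius a i),
      torusCoeff f ν * mixedWeight J a T i ν * torusExp ν x‖ₑ ^ 2) i
    have h3 := ENNReal.toReal_mono hx.ne h2
    simpa using h3
  have h4 : ∏ j ∈ T, ((p j : ℝ) + 1) ≤ (∏ j ∈ T, (2 : ℝ)) * ∏ j ∈ T, (p j : ℝ) := by
    rw [← Finset.prod_mul_distrib]
    refine Finset.prod_le_prod (fun j _ => by positivity) fun j hj => ?_
    have : (1 : ℝ) ≤ p j := by exact_mod_cast hp j hj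
    linarith
  calc _ ≤ (((∏ j ∈ T, (2 : ℝ)) * ∏ j ∈ T, (p j : ℝ)) *
        ∏ l ∈ (J ∪ T)ᶜ, √(Real.log ((m l : ℝ) + 2))) * √A.toReal := by gcongr
    _ = _ := by ring
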